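/- Let $d\in\mathbb N$, $T>0$, and let $\sigma:\mathbb R^d\to\mathbb R^d$, $w:\mathbb R\to\mathbb R^{d\times d}$, $b:\mathbb R\to\mathbb R^d$ be such that (A1) $\sigma,w,b$ are Lipschitz and (A2) $\sigma$ is bounded. Write points of $\mathbb R^{d+1}$ as $(x,\tau)$ with $x\in\mathbb R^d$, $\tau\in\mathbb R$, use the Euclidean norm, and put $G(x,\tau)=(\sigma(w(\tau)x+b(\tau)),1)$. Let $\mathcal P_1(\mathbb R^{d+1})$ be the set of Borel probability measures with finite first moment, with the 1-Wasserstein distance $W_1(\mu,\nu)=\inf_\pi\int|y-z|\,d\pi(y,z)$, the infimum being over all transport plans $\pi$ from $\mu$ to $\nu$. For $F_0\in\mathcal P_1(\mathbb R^{d+1})$, a curve $F\in C([0,T];\mathcal P_1(\mathbb R^{d+1}))$ is a weak solution of $$\partial_tF_t+\nabla_x\cdot\big(\sigma(w(\tau)x+b(\tau))F_t\big)+\partial_\tau F_t=0$$ with initial condition $F_0$ if for all $\phi\in C_c^\infty(\mathbb R^{d+1})$ and $t\in[0,T]$ $$\int\phi\,dF_t=\int\phi\,dF_0+\int_0^t\int\nabla_{(x,\tau)}\phi\cdot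 G\,dF_s\,ds.$$ Then: 1. (Well-posedness) There is a flow $\Phi_t:\mathbb R^{d+1}\to\mathbb R^{d+1}$, $t\in[0,T]$, with $\partial_t\Phi_t(z)=G(\Phi_t(z))$ and $\Phi_0(z)=z$; it is unique and each $\Phi_t$ is continuous. For every $F_0\in\mathcal P_1(\mathbb R^{d+1})$ the curve $F_t=\Phi_t\#F_0$ is the unique weak solution with initial condition $F_0$. 2. (Continuous dependence) Let $F$ be the weak solution with initial condition $F_0\in\mathcal P_1(\mathbb R^{d+1})$. For every $\varepsilon>0$ there is $\delta>0$ such that every weak solution $F'$ with initial condition $F_0'\in\mathcal P_1(\mathbb R^{d+1})$ and $W_1(F_0,F_0')<\delta$ satisfies $W_1(F_t,F'_t)<\varepsilon$ for all $t\in[0,T]$. 3. (Dobrushin estimate) For every set $A\subseteq\mathbb R$ on which $w$ is bounded there is a constant $C\geq 0$ (depending only on $\sigma,w,b,T,A$) such that for all weak solutions $F,F'$ whose initial conditions $F_0,F_0'\in\mathcal P_1(\mathbb R^{d+1})$ are concentrated on $\mathbb R^d\times A$, $$W_1(F_t,F_t')\le C\,W_1(F_0,F_0')\qquad\text{for all }t\in[0,T].$$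 (In particular, $A=\mathbb R$ is allowed if $w$ is bounded, and every bounded $A$ is allowed.) 4. (Mean-field limit) For each $M$ let $x^0_{M,1},\dots,x^0_{M,M}\in\mathbb R^d$, let $(x_{M,i},\tau_{M,i})$ solve on $[0,T]$ the particle system $\dot x_{M,i}=\sigma(w(\tau_{M,i})x_{M,i}+b(\tau_{M,i}))$, $\dot\tau_{M,i}=1$, with $x_{M,i}(0)=x^0_{M,i}$, $\tau_{M,i}(0)=0$, and for $M\ge1$ let $F^M_t=\frac1M\sum_{i=1}^M\delta_{(x_{M,i}(t),\tau_{M,i}(t))}$. If $W_1(F_0,F^M_0)\to0$ as $M\to\infty$ for some $F_0\in\mathcal P_1(\mathbb R^{d+1})$ with weak solution $F$, then $W_1(F_t,F_t^M)\le C\,W_1(F_0,F_0^M)$ for all $M\ge1$ and $t\in[0,T]$, with $C$ depending only on $\sigma,w,b,T$, and hence $\sup_{t\in[0,T]}W_1(F_t,F^M_t)\to0$ as $M\to\infty$. -/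

import Mathlib

open scoped ENNReal NNReal Topology ContDiff Matrix Matrix.Norms.L2Operator
open MeasureTheory Set Filter

noncomputable section

/-- The Euclidean space `ℝ^d`. -/
abbrev Vec (d : ℕ) : Type := EuclideanSpace ℝ (Fin d)

/-- The phase space `ℝ^{d+1}` of points `(x, τ)`, `x ∈ ℝ^d`, `τ ∈ ℝ`, with the Euclidean norm;
`τ` is the last coordinate. -/
abbrev Phase (d : ℕ) : Type := EuclideanSpace ℝ (Fin (d + 1))

/-- The point `(x, τ)` of `ℝ^{d+1}`. -/
def phasePt {d : ℕ} (x : Vec d) (τ : ℝ) : Phase d :=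
  WithLp.toLp 2 (Fin.snoc (α := fun _ => ℝ) (fun i => x i) τ)

/-- The component `x` of `(x, τ)`. -/
def xPart {d : ℕ} (z : Phase d) : Vec d := WithLp.toLp 2 (fun i => z i.castSucc)

/-- The component `τ` of `(x, τ)`. -/
def tauPart {d : ℕ} (z : Phase d) : ℝ := z (Fin.last d)

/-- The vector `σ(w(τ) x + b(τ))`. -/
def layer {d : ℕ} (σ : Vec d → Vec d) (w : ℝ → Matrix (Fin d) (Fin d) ℝ) (b : ℝ → Vec d)
    (τ : ℝ) (x : Vec d) : Vec d :=
  σ (Matrix.toEuclideanCLM (n := Fin d) (𝕜 := ℝ) (w τ) x + b τ)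

/-- The vector field `G(x, τ) = (σ(w(τ) x + b(τ)), 1)`. -/
def fieldG {d : ℕ} (σ : Vec d → Vec d) (w : ℝ → Matrix (Fin d) (Fin d) ℝ) (b : ℝ → Vec d)
    (z : Phase d) : Phase d :=
  phasePt (layer σ w b (tauPart z) (xPart z)) 1

/-- `μ` is a Borel probability measure with finite first moment. -/
def IsP1 {E : Type*} [NormedAddCommGroup E] [MeasurableSpace E] (μ : Measure E) : Prop :=
  IsProbabilityMeasure μ ∧ ∫⁻ z, ‖z‖ₑ ∂μ < ⊤

/-- The admissible transport plans from `μ` to `ν`. -/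
def transportPlans {E : Type*} [MeasurableSpace E] (μ ν : Measure E) : Set (Measure (E × E)) :=
  {π | π.map Prod.fst = μ ∧ π.map Prod.snd = ν}

/-- The `1`-Wasserstein distance: the least cost `∫ |x - y| dπ(x, y)` of a transport plan. -/
def wass1 {E : Type*} [NormedAddCommGroup E] [MeasurableSpace E] (μ ν : Measure E) : ℝ≥0∞ :=
  ⨅ π ∈ transportPlans μ ν, ∫⁻ p, ‖p.1 - p.2‖ₑ ∂π

/-- `F ∈ C([0,T]; P_1)`, where `P_1` carries the `1`-Wasserstein distance. -/
def IsContinuousCurve {E : Type*} [NormedAddCommGroup E] [MeasurableSpace E] (T : ℝ)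
    (F : ℝ → Measure E) : Prop :=
  (∀ t ∈ Icc 0 T, IsP1 (F t)) ∧
    ∀ t ∈ Icc 0 T, Tendsto (fun s => wass1 (F s) (F t)) (𝓝[Icc 0 T] t) (𝓝 0)

/-- `F` is a weak solution on `[0,T]`, with initial condition `F₀`, of
`∂_t F + ∇_x · (σ(w(τ) x + b(τ)) F) + ∂_τ F = 0`. Here `fderiv ℝ φ z (G z)` is
`∇_{(x,τ)} φ(z) · G(z)`. -/
def IsWeakSolution {d : ℕ} (σ : Vec d → Vec d) (w : ℝ → Matrix (Fin d) (Fin d) ℝ)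
    (b : ℝ → Vec d) (T : ℝ) (F₀ : Measure (Phase d)) (F : ℝ → Measure (Phase d)) : Prop :=
  IsContinuousCurve T F ∧
    ∀ φ : Phase d → ℝ, ContDiff ℝ ∞ φ → HasCompactSupport φ → ∀ t ∈ Icc 0 T,
      (∫ z, φ z ∂(F t)) =
        (∫ z, φ z ∂F₀) + ∫ s in (0 : ℝ)..t, (∫ z, fderiv ℝ φ z (fieldG σ w b z) ∂(F s))

/-- `Φ_t`, `t ∈ [0,T]`, is the characteristic flow: `∂_t Φ_t(z) = G(Φ_t(z))`, `Φ_0(z) = z`. -/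
def IsCharFlow {d : ℕ} (σ : Vec d → Vec d) (w : ℝ → Matrix (Fin d) (Fin d) ℝ)
    (b : ℝ → Vec d) (T : ℝ) (Φ : ℝ → Phase d → Phase d) : Prop :=
  ∀ z, Φ 0 z = z ∧ ∀ t ∈ Icc 0 T,
    HasDerivWithinAt (fun s => Φ s z) (fieldG σ w b (Φ t z)) (Icc 0 T) t

/-- `(x(t), τ(t))`, `t ∈ [0,T]`, is a particle trajectory of the autonomized system
`x' = σ(w(τ) x + b(τ))`, `x(0) = x₀`, `τ' = 1`, `τ(0) = 0`. -/
def IsTrajectory {d : ℕ} (σ : Vec d → Vec d) (w : ℝ → Matrix (Fin d) (Fin d) ℝ)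
    (b : ℝ → Vec d) (T : ℝ) (x₀ : Vec d) (x : ℝ → Vec d) (τ : ℝ → ℝ) : Prop :=
  (x 0 = x₀ ∧ ∀ t ∈ Icc 0 T, HasDerivWithinAt x (layer σ w b (τ t) (x t)) (Icc 0 T) t) ∧
    (τ 0 = 0 ∧ ∀ t ∈ Icc 0 T, HasDerivWithinAt τ 1 (Icc 0 T) t)

/-- The empirical measure `(1/M) ∑_i δ_{z_i}` (used for `M ≥ 1`). -/
def empirical {E : Type*} [MeasurableSpace E] {M : ℕ} (z : Fin M → E) : Measure E :=
  (M : ℝ≥0∞)⁻¹ • ∑ i, Measure.dirac (z i)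

end

/-! ### Coordinates on phase space -/

section PhaseSpace

variable {d : ℕ}

/-! The field `G` is bounded and continuous but need not be globally Lipschitz: changing `τ` changes
`w(τ)x` by an amount that grows with `|x|`. The remedy is that `τ` moves at unit speed along every
characteristic. Two curves with the same `τ` see a field that is Lipschitz in `x`, and Grönwall
applies. If the values of `τ` differ by `δ`, the lower curve is first run for time `δ`, which costs
at most a multiple of `δ` because `G` is bounded. Hence `Φ_t` is Lipschitz on starting points whose
`τ` lies in a set where `w` is bounded (`IsCharFlow.norm_sub_le`, `IsCharFlow.exists_lipschitz`).
Pushing transport plans forward gives the Dobrushin estimate.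

The rest of the well-posedness theory uses only a bounded continuous field whose flow is Lipschitz
on balls (`IsBoundedFlow`). The push-forward is a weak solution by the chain rule and Fubini.
Uniqueness is by duality: `∫ φ ∘ Φ_u dF_{t-u}` should not depend on `u`. Since `φ ∘ Φ_u` is only
Lipschitz, it is mollified in space. Up to `o(h)`, passing from `Φ_u` to `Φ_{u+h}` translates the
argument by `h • G z` (`IsBoundedFlow.exists_abs_comp_sub_le`), and a translation commutes with
convolution, so the mollified pairing has arbitrarily small slope.

For continuous dependence, the Lipschitz bound serves on a large ball; outside it the bounded
displacement is a small multiple of the norm, which the first moment of `F₀` controls. For the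
mean-field limit, data on `τ = 0` can only converge in `W₁` to data on `τ = 0`, so the Dobrushin
estimate with `A = {0}` applies. -/

@[simp] lemma xPart_phasePt (x : Vec d) (τ : ℝ) : xPart (phasePt x τ) = x := by
  ext i; simp [xPart, phasePt]

@[simp] lemma tauPart_phasePt (x : Vec d) (τ : ℝ) : tauPart (phasePt x τ) = τ := by
  simp [tauPart, phasePt]

@[simp] lemma phasePt_xPart_tauPart (z : Phase d) : phasePt (xPart z) (tauPart z) = z := by
  ext i
  refine Fin.lastCases ?_ (fun j => ?_) i <;> simp [xPart, tauPart, phasePt]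

lemma norm_sq_eq_xPart_add_tauPart (z : Phase d) :
    ‖z‖ ^ 2 = ‖xPart z‖ ^ 2 + tauPart z ^ 2 := by
  simp [EuclideanSpace.norm_sq_eq, Fin.sum_univ_castSucc, xPart, tauPart]

lemma norm_xPart_le (z : Phase d) : ‖xPart z‖ ≤ ‖z‖ :=
  abs_le_of_sq_le_sq' (by nlinarith [norm_sq_eq_xPart_add_tauPart z, sq_nonneg (tauPart z)])
    (norm_nonneg z) |>.2

lemma abs_tauPart_le (z : Phase d) : |tauPart z| ≤ ‖z‖ :=
  abs_le_of_sq_le_sq (by nlinarith [norm_sq_eq_xPart_add_tauPart z, sq_nonneg ‖xPart z‖])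
    (norm_nonneg z)

lemma norm_le_norm_xPart_add_abs_tauPart (z : Phase d) : ‖z‖ ≤ ‖xPart z‖ + |tauPart z| := by
  refine abs_le_of_sq_le_sq' ?_ (by positivity) |>.2
  nlinarith [norm_sq_eq_xPart_add_tauPart z, sq_abs (tauPart z),
    mul_nonneg (norm_nonneg (xPart z)) (abs_nonneg (tauPart z))]

/-- The projection `(x, τ) ↦ x` as a continuous linear map. -/
noncomputable def xPartL (d : ℕ) : Phase d →L[ℝ] Vec d :=
  LinearMap.toContinuousLinearMap
    { toFun := xPart, map_add' := fun _ _ => rfl, map_smul' := fun _ _ => rfl }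

/-- The projection `(x, τ) ↦ τ` as a continuous linear map. -/
noncomputable def tauPartL (d : ℕ) : Phase d →L[ℝ] ℝ :=
  LinearMap.toContinuousLinearMap
    { toFun := tauPart, map_add' := fun _ _ => rfl, map_smul' := fun _ _ => rfl }

/-- The map `(x, τ) ↦ phasePt x τ` as a continuous linear map. -/
noncomputable def phasePtL (d : ℕ) : Vec d × ℝ →L[ℝ] Phase d :=
  LinearMap.toContinuousLinearMap
    { toFun := fun p => phasePt p.1 p.2
      map_add' := fun p q => by
        ext i
        refine Fin.lastCases ?_ (fun j => ?_) i <;> simp [phasePt]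
      map_smul' := fun c p => by
        ext i
        refine Fin.lastCases ?_ (fun j => ?_) i <;> simp [phasePt] }

lemma xPart_sub (y z : Phase d) : xPart (y - z) = xPart y - xPart z := rfl
lemma tauPart_sub (y z : Phase d) : tauPart (y - z) = tauPart y - tauPart z := rfl

lemma continuous_xPart : Continuous (xPart : Phase d → Vec d) := (xPartL d).continuous
lemma continuous_tauPart : Continuous (tauPart : Phase d → ℝ) := (tauPartL d).continuous

lemma HasDerivWithinAt.phasePt {x : ℝ → Vec d} {τ : ℝ → ℝ} {x' : Vec d} {τ' t : ℝ} {s : Set ℝ}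
    (hx : HasDerivWithinAt x x' s t) (hτ : HasDerivWithinAt τ τ' s t) :
    HasDerivWithinAt (fun r => phasePt (x r) (τ r)) (phasePt x' τ') s t :=
  (phasePtL d).hasFDerivAt.comp_hasDerivWithinAt t (hx.prodMk hτ)

lemma HasDerivWithinAt.tauPart {z : ℝ → Phase d} {z' : Phase d} {t : ℝ} {s : Set ℝ}
    (hz : HasDerivWithinAt z z' s t) :
    HasDerivWithinAt (fun r => tauPart (z r)) (tauPart z') s t :=
  (tauPartL d).hasFDerivAt.comp_hasDerivWithinAt t hz

end PhaseSpace

/-! ### Regularity of the vector field -/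

section Field

variable {d : ℕ} {σ : Vec d → Vec d} {w : ℝ → Matrix (Fin d) (Fin d) ℝ} {b : ℝ → Vec d}

lemma norm_layer_sub_le {K : ℝ≥0} (hσ : LipschitzWith K σ) (τ : ℝ) (x y : Vec d) :
    ‖layer σ w b τ x - layer σ w b τ y‖ ≤ K * ‖w τ‖ * ‖x - y‖ := by
  refine (hσ.norm_sub_le _ _).trans ?_
  rw [add_sub_add_right_eq_sub, ← map_sub, mul_assoc]
  gcongr
  rw [← Matrix.l2_opNorm_toEuclideanCLM]
  exact ContinuousLinearMap.le_opNorm _ _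

lemma continuous_layer (hσ : Continuous σ) (hw : Continuous w) (hb : Continuous b) :
    Continuous fun p : ℝ × Vec d => layer σ w b p.1 p.2 := by
  have hiso : Continuous (Matrix.toEuclideanCLM (n := Fin d) (𝕜 := ℝ)) :=
    (AddMonoidHomClass.isometry_of_norm _ fun A => Matrix.l2_opNorm_toEuclideanCLM A).continuous
  unfold layer
  exact hσ.comp ((((hiso.comp hw).comp continuous_fst).clm_apply continuous_snd).add
    (hb.comp continuous_fst))

lemma continuous_fieldG (hσ : Continuous σ) (hw : Continuous w) (hb : Continuous b) :
    Continuous (fieldG σ w b) :=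
  (phasePtL d).continuous.comp (((continuous_layer hσ hw hb).comp
    (continuous_tauPart.prodMk continuous_xPart)).prodMk continuous_const)

lemma norm_fieldG_le {C₀ : ℝ} (hσb : ∀ x, ‖σ x‖ ≤ C₀) (z : Phase d) :
    ‖fieldG σ w b z‖ ≤ C₀ + 1 := by
  refine (norm_le_norm_xPart_add_abs_tauPart _).trans ?_
  simp only [fieldG, xPart_phasePt, tauPart_phasePt, abs_one]
  gcongr
  exact hσb _

/-- On a slice of constant `τ` only the argument `x` varies, so the variation of `w` and `b` never
enters. -/
lemma lipschitzOnWith_fieldG {K : ℝ≥0} (hσ : LipschitzWith K σ) {τ : ℝ} {B : ℝ≥0}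
    (hB : ‖w τ‖ ≤ B) : LipschitzOnWith (K * B) (fieldG σ w b) {z | tauPart z = τ} := by
  refine LipschitzOnWith.of_dist_le_mul fun y hy z hz => ?_
  simp only [mem_ofPred_eq] at hy hz
  rw [dist_eq_norm, dist_eq_norm]
  refine (norm_le_norm_xPart_add_abs_tauPart _).trans ?_
  simp only [fieldG, xPart_sub, tauPart_sub, xPart_phasePt, tauPart_phasePt, sub_self, abs_zero,
    add_zero, hy, hz]
  refine (norm_layer_sub_le hσ τ _ _).trans ?_
  rw [← xPart_sub]
  push_cast
  gcongr
  exact norm_xPart_le _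

end Field

/-! ### Integral curves: comparison and existence -/

section Curves

variable {d : ℕ} {σ : Vec d → Vec d} {w : ℝ → Matrix (Fin d) (Fin d) ℝ} {b : ℝ → Vec d}

lemma hasDerivWithinAt_Ici_of_Icc {E : Type*} [NormedAddCommGroup E] [NormedSpace ℝ E]
    {f : ℝ → E} {f' : E} {a c t : ℝ} (h : HasDerivWithinAt f f' (Icc a c) t) (ht : t ∈ Ico a c) :
    HasDerivWithinAt f f' (Ici t) t :=
  h.mono_of_mem_nhdsWithin (mem_of_superset (Icc_mem_nhdsGE ht.2) (Icc_subset_Icc_left ht.1))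

lemma norm_sub_le_of_curve {E : Type*} [NormedAddCommGroup E] [NormedSpace ℝ E]
    {f f' : ℝ → E} {C a c : ℝ} (hf : ∀ t ∈ Icc a c, HasDerivWithinAt f (f' t) (Icc a c) t)
    (hC : ∀ t, ‖f' t‖ ≤ C) {s t : ℝ} (hs : s ∈ Icc a c) (ht : t ∈ Icc a c) :
    ‖f t - f s‖ ≤ C * |t - s| :=
  (convex_Icc a c).norm_image_sub_le_of_norm_hasDerivWithin_le hf (fun t _ => hC t) hs ht

lemma tauPart_eq_of_curve {S : ℝ} {z : ℝ → Phase d}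
    (hz : ∀ t ∈ Icc 0 S, HasDerivWithinAt z (fieldG σ w b (z t)) (Icc 0 S) t)
    {t : ℝ} (ht : t ∈ Icc 0 S) : tauPart (z t) = tauPart (z 0) + t := by
  have h := norm_sub_le_of_curve (f := fun r => tauPart (z r) - r) (f' := fun _ => (0 : ℝ)) (C := 0)
    (fun r hr => by
      have := (hz r hr).tauPart.sub (hasDerivWithinAt_id r _)
      simpa [fieldG] using! this) (by simp) (left_mem_Icc.2 (ht.1.trans ht.2)) ht
  simp only [zero_mul, norm_le_zero_iff] at h
  linarith

/-- Grönwall estimate for two integral curves with the same `τ`-component. -/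
lemma norm_sub_le_exp_of_curves {K B : ℝ≥0} (hσ : LipschitzWith K σ) {S : ℝ}
    {y z : ℝ → Phase d}
    (hy : ∀ t ∈ Icc 0 S, HasDerivWithinAt y (fieldG σ w b (y t)) (Icc 0 S) t)
    (hz : ∀ t ∈ Icc 0 S, HasDerivWithinAt z (fieldG σ w b (z t)) (Icc 0 S) t)
    (hτ : tauPart (y 0) = tauPart (z 0)) (hB : ∀ t ∈ Icc 0 S, ‖w (tauPart (y 0) + t)‖ ≤ B)
    {t : ℝ} (ht : t ∈ Icc 0 S) :
    ‖y t - z t‖ ≤ ‖y 0 - z 0‖ * Real.exp (K * B * S) := by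
  -- Both curves stay in the moving slice `τ = τ₀ + t`, and Grönwall needs the Lipschitz bound only
  -- there.
  have h := dist_le_of_trajectories_ODE_of_mem (v := fun _ => fieldG σ w b)
    (s := fun t => {z | tauPart z = tauPart (y 0) + t}) (K := K * B) (a := 0) (b := S)
    (fun t ht => lipschitzOnWith_fieldG hσ (hB t (Ico_subset_Icc_self ht)))
    (fun t ht => (hy t ht).continuousWithinAt)
    (fun t ht => hasDerivWithinAt_Ici_of_Icc (hy t (Ico_subset_Icc_self ht)) ht)
    (fun t ht => tauPart_eq_of_curve hy (Ico_subset_Icc_self ht))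
    (fun t ht => (hz t ht).continuousWithinAt)
    (fun t ht => hasDerivWithinAt_Ici_of_Icc (hz t (Ico_subset_Icc_self ht)) ht)
    (fun t ht => by
      rw [hτ]; exact tauPart_eq_of_curve hz (Ico_subset_Icc_self ht)) le_rfl t ht
  rw [dist_eq_norm, dist_eq_norm] at h
  refine h.trans ?_
  have := ht.2
  push_cast
  rw [sub_zero]
  gcongr

lemma exists_norm_le_of_continuous {w : ℝ → Matrix (Fin d) (Fin d) ℝ} (hw : Continuous w)
    (a c : ℝ) : ∃ B : ℝ≥0, ∀ τ ∈ Icc a c, ‖w τ‖ ≤ B := by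
  obtain ⟨B, hB⟩ := isCompact_Icc.exists_bound_of_continuousOn (hw.continuousOn (s := Icc a c))
  exact ⟨B.toNNReal, fun τ hτ => (hB τ hτ).trans (Real.le_coe_toNNReal B)⟩

lemma eqOn_of_curves (hσ : ∃ K : ℝ≥0, LipschitzWith K σ) (hw : Continuous w) {S : ℝ}
    {y z : ℝ → Phase d}
    (hy : ∀ t ∈ Icc 0 S, HasDerivWithinAt y (fieldG σ w b (y t)) (Icc 0 S) t)
    (hz : ∀ t ∈ Icc 0 S, HasDerivWithinAt z (fieldG σ w b (z t)) (Icc 0 S) t)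
    (h0 : y 0 = z 0) {t : ℝ} (ht : t ∈ Icc 0 S) : y t = z t := by
  obtain ⟨K, hσ⟩ := hσ
  obtain ⟨B, hB⟩ := exists_norm_le_of_continuous hw (tauPart (y 0)) (tauPart (y 0) + S)
  have h := norm_sub_le_exp_of_curves hσ hy hz (by rw [h0])
    (fun t ht => hB _ ⟨by linarith [ht.1], by linarith [ht.2]⟩) ht
  simpa [h0, sub_eq_zero] using h

lemma exists_curve (hσ : ∃ K : ℝ≥0, LipschitzWith K σ) (hw : Continuous w) (hb : Continuous b)
    (hσb : ∃ C₀ : ℝ, ∀ x, ‖σ x‖ ≤ C₀) {T : ℝ} (hT : 0 ≤ T) (z₀ : Phase d) :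
    ∃ z : ℝ → Phase d, z 0 = z₀ ∧
      ∀ t ∈ Icc 0 T, HasDerivWithinAt z (fieldG σ w b (z t)) (Icc 0 T) t := by
  obtain ⟨K, hσ⟩ := hσ
  obtain ⟨C, hC⟩ := hσb
  obtain ⟨B, hB⟩ := exists_norm_le_of_continuous hw (tauPart z₀) (tauPart z₀ + T)
  -- With `τ = τ₀ + t` substituted, the equation for `x` is globally Lipschitz and bounded. The
  -- radius is speed times time, so a single application covers `[0,T]`.
  have hpl : IsPicardLindelof (fun t x => layer σ w b (tauPart z₀ + t) x)
      (⟨0, left_mem_Icc.2 hT⟩ : Icc 0 T) (xPart z₀) (C.toNNReal * T.toNNReal) 0 C.toNNReal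
      (K * B) := by
    refine ⟨fun t ht => LipschitzOnWith.of_dist_le_mul fun x _ y _ => ?_, fun x _ => ?_,
      fun t _ x _ => (hC _).trans (Real.le_coe_toNNReal C), ?_⟩
    · rw [dist_eq_norm, dist_eq_norm]
      refine (norm_layer_sub_le hσ _ _ _).trans ?_
      push_cast
      gcongr
      exact hB _ ⟨by linarith [ht.1], by linarith [ht.2]⟩
    · exact ((continuous_layer hσ.continuous hw hb).comp
        ((continuous_const.add continuous_id).prodMk continuous_const)).continuousOn
    · simp [hT]
  obtain ⟨x, hx0, hx⟩ := hpl.exists_eq_forall_mem_Icc_hasDerivWithinAt₀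
  refine ⟨fun t => phasePt (x t) (tauPart z₀ + t), by simp [show x 0 = xPart z₀ from hx0], ?_⟩
  intro t ht
  have h := (hx t ht).phasePt ((hasDerivWithinAt_id t (Icc 0 T)).const_add (tauPart z₀))
  simpa [fieldG] using h

end Curves

/-! ### Flows of bounded fields -/

section BoundedFlow

/-- `Φ_t`, `t ∈ [0,T]`, is the flow of the continuous vector field `G`, which is bounded by `C`;
the maps `Φ_t` are Lipschitz on balls, uniformly in `t`. -/
structure IsBoundedFlow {E : Type*} [NormedAddCommGroup E] [NormedSpace ℝ E] (G : E → E)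
    (T C : ℝ) (Φ : ℝ → E → E) : Prop where
  continuous_field : Continuous G
  norm_field_le : ∀ z, ‖G z‖ ≤ C
  zero : ∀ z, Φ 0 z = z
  hasDerivWithinAt : ∀ z, ∀ t ∈ Icc 0 T,
    HasDerivWithinAt (fun s => Φ s z) (G (Φ t z)) (Icc 0 T) t
  add : ∀ z, ∀ u h : ℝ, 0 ≤ u → 0 ≤ h → u + h ≤ T → Φ (u + h) z = Φ u (Φ h z)
  lipschitzOnWith : ∀ R : ℝ, ∃ L : ℝ≥0, ∀ t ∈ Icc 0 T,
    LipschitzOnWith L (Φ t) (Metric.closedBall 0 R)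

namespace IsBoundedFlow

variable {E : Type*} [NormedAddCommGroup E] [NormedSpace ℝ E] {G : E → E} {T C : ℝ}
  {Φ : ℝ → E → E}

lemma norm_sub_le (hΦ : IsBoundedFlow G T C Φ) (z : E) {s t : ℝ} (hs : s ∈ Icc 0 T)
    (ht : t ∈ Icc 0 T) : ‖Φ t z - Φ s z‖ ≤ C * |t - s| :=
  (convex_Icc 0 T).norm_image_sub_le_of_norm_hasDerivWithin_le (hΦ.hasDerivWithinAt z)
    (fun _ _ => hΦ.norm_field_le _) hs ht

lemma norm_sub_self_le (hΦ : IsBoundedFlow G T C Φ) (z : E) {t : ℝ} (ht : t ∈ Icc 0 T) :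
    ‖Φ t z - z‖ ≤ C * t := by
  have h := hΦ.norm_sub_le z (left_mem_Icc.2 (ht.1.trans ht.2)) ht
  rwa [hΦ.zero, sub_zero, abs_of_nonneg ht.1] at h

lemma bound_nonneg (hΦ : IsBoundedFlow G T C Φ) : 0 ≤ C :=
  (norm_nonneg _).trans (hΦ.norm_field_le 0)

protected lemma continuous (hΦ : IsBoundedFlow G T C Φ) {t : ℝ} (ht : t ∈ Icc 0 T) :
    Continuous (Φ t) := by
  refine continuous_iff_continuousAt.2 fun z => ?_
  obtain ⟨L, hL⟩ := hΦ.lipschitzOnWith (‖z‖ + 1)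
  refine (hL t ht).continuousOn.continuousAt (mem_of_superset (Metric.ball_mem_nhds z one_pos) ?_)
  intro y hy
  rw [mem_ball_iff_norm] at hy
  rw [mem_closedBall_zero_iff]
  linarith [norm_le_insert' y z]

lemma continuousOn_curve (hΦ : IsBoundedFlow G T C Φ) (z : E) :
    ContinuousOn (fun t => Φ t z) (Icc 0 T) :=
  fun t ht => (hΦ.hasDerivWithinAt z t ht).continuousWithinAt

/-- Off large balls the displacement bound replaces the Lipschitz bound. -/
lemma exists_norm_sub_le_add (hΦ : IsBoundedFlow G T C Φ) {k : ℝ≥0} (hk : 0 < k) :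
    ∃ D : ℝ≥0, 0 < D ∧ ∀ t ∈ Icc 0 T, ∀ y z, ‖Φ t y - Φ t z‖ ≤ D * ‖y - z‖ + k * ‖y‖ := by
  have hC := hΦ.bound_nonneg
  -- Beyond radius `2CT/k` the displacement `2CT` is at most `k‖y‖`; the extra `1` makes room for
  -- `z` with `‖y - z‖ ≤ 1`.
  obtain ⟨L, hL⟩ := hΦ.lipschitzOnWith (2 * C * T / k + 1)
  -- The last summand serves the case `‖y - z‖ > 1`, where `2CT ≤ 2CT‖y - z‖`.
  refine ⟨L + 1 + (2 * C * T).toNNReal, by positivity, fun t ht y z => ?_⟩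
  have hCt : C * t ≤ C * T := mul_le_mul_of_nonneg_left ht.2 hC
  have hCT : 0 ≤ 2 * C * T := by have := ht.1.trans ht.2; positivity
  have htri : ‖Φ t y - Φ t z‖ ≤ ‖y - z‖ + 2 * C * T := by
    have h1 := hΦ.norm_sub_self_le y ht
    have h2 := hΦ.norm_sub_self_le z ht
    have h3 := norm_sub_le_norm_sub_add_norm_sub (Φ t y) y (Φ t z)
    have h4 := norm_sub_le_norm_sub_add_norm_sub y z (Φ t z)
    rw [norm_sub_rev z] at h4
    linarith
  have h0 : 0 ≤ (k : ℝ) * ‖y‖ := by positivity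
  have h1 : 0 ≤ (L : ℝ) * ‖y - z‖ := by positivity
  have h2 : 0 ≤ 2 * C * T * ‖y - z‖ := by positivity
  have h3 := norm_nonneg (y - z)
  push_cast
  rw [Real.coe_toNNReal _ hCT, add_mul, add_mul]
  rcases le_or_gt ‖y‖ (2 * C * T / k) with hy | hy
  · rcases le_or_gt ‖y - z‖ 1 with hyz | hyz
    · have := (hL t ht).norm_sub_le (x := y) (y := z)
        (mem_closedBall_zero_iff.2 (by linarith))
        (mem_closedBall_zero_iff.2 (by linarith [norm_le_insert y z]))
      linarith
    · nlinarith
  · rw [div_lt_iff₀ (by exact_mod_cast hk)] at hy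
    nlinarith

end IsBoundedFlow

end BoundedFlow

/-! ### The characteristic flow -/

section CharFlow

variable {d : ℕ} {σ : Vec d → Vec d} {w : ℝ → Matrix (Fin d) (Fin d) ℝ} {b : ℝ → Vec d}
  {T : ℝ} {Φ : ℝ → Phase d → Phase d}

lemma IsCharFlow.eq (hσ : ∃ K : ℝ≥0, LipschitzWith K σ) (hw : Continuous w)
    (hΦ : IsCharFlow σ w b T Φ) {z : ℝ → Phase d}
    (hz : ∀ t ∈ Icc 0 T, HasDerivWithinAt z (fieldG σ w b (z t)) (Icc 0 T) t)
    {t : ℝ} (ht : t ∈ Icc 0 T) : z t = Φ t (z 0) :=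
  eqOn_of_curves hσ hw hz (hΦ (z 0)).2 (hΦ (z 0)).1.symm ht

lemma exists_isCharFlow (hσ : ∃ K : ℝ≥0, LipschitzWith K σ) (hw : Continuous w)
    (hb : Continuous b) (hσb : ∃ C₀ : ℝ, ∀ x, ‖σ x‖ ≤ C₀) (hT : 0 ≤ T) :
    ∃ Φ : ℝ → Phase d → Phase d, IsCharFlow σ w b T Φ := by
  choose Z h0 hd using exists_curve hσ hw hb hσb hT
  exact ⟨fun t z => Z z t, fun z => ⟨h0 z, hd z⟩⟩

/-- The curve `s ↦ Φ_{h + s}(z)` solves the characteristic equation on `[0, S]`, `h + S ≤ T`. -/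
lemma IsCharFlow.hasDerivWithinAt_shift (hΦ : IsCharFlow σ w b T Φ) (z : Phase d) {h S : ℝ}
    (hh : 0 ≤ h) (hS : h + S ≤ T) : ∀ t ∈ Icc 0 S,
      HasDerivWithinAt (fun s => Φ (h + s) z) (fieldG σ w b (Φ (h + t) z)) (Icc 0 S) t := by
  intro t ht
  have h1 := (hΦ z).2 (h + t) ⟨by linarith [ht.1], by linarith [ht.2]⟩
  have h2 := h1.scomp t ((hasDerivWithinAt_id t (Icc 0 S)).const_add h)
    (fun s hs => ⟨by linarith [hs.1], by linarith [hs.2]⟩)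
  simpa using! h2

lemma IsCharFlow.hasDerivWithinAt_restrict (hΦ : IsCharFlow σ w b T Φ) (z : Phase d) {S : ℝ}
    (hS : S ≤ T) : ∀ t ∈ Icc 0 S,
      HasDerivWithinAt (fun s => Φ s z) (fieldG σ w b (Φ t z)) (Icc 0 S) t :=
  fun t ht => ((hΦ z).2 t ⟨ht.1, ht.2.trans hS⟩).mono (Icc_subset_Icc_right hS)

/-- The characteristic flow is Lipschitz on starting points whose `τ` ranges over a set near which
`w` is bounded: comparing the curves at equal values of `τ` avoids the growth in `x` of the
`τ`-dependence of the field. -/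
lemma IsCharFlow.norm_sub_le (hΦ : IsCharFlow σ w b T Φ) {K B : ℝ≥0} (hσ : LipschitzWith K σ)
    {C : ℝ} (hC : ∀ z, ‖fieldG σ w b z‖ ≤ C) {y z : Phase d}
    (hy : ∀ r ∈ Icc (tauPart y) (tauPart y + T), ‖w r‖ ≤ B)
    (hz : ∀ r ∈ Icc (tauPart z) (tauPart z + T), ‖w r‖ ≤ B) {t : ℝ} (ht : t ∈ Icc 0 T) :
    ‖Φ t y - Φ t z‖ ≤ ((1 + C) * Real.exp (K * B * T) + C) * ‖y - z‖ := by
  wlog hyz : tauPart y ≤ tauPart z generalizing y z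
  · rw [norm_sub_rev, norm_sub_rev y z]
    exact this hz hy (le_of_not_ge hyz)
  have hC0 : 0 ≤ C := (norm_nonneg _).trans (hC 0)
  have hT : 0 ≤ T := ht.1.trans ht.2
  have hexp : 1 ≤ Real.exp (K * B * T) := Real.one_le_exp (by positivity)
  obtain ⟨δ, hδ⟩ : ∃ δ, δ = tauPart z - tauPart y := ⟨_, rfl⟩
  have hδ0 : 0 ≤ δ := by linarith
  have hδle : δ ≤ ‖y - z‖ := by
    rw [hδ, norm_sub_rev, ← tauPart_sub]; exact (le_abs_self _).trans (abs_tauPart_le _)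
  have hmove : ∀ (p : Phase d) {s r : ℝ}, s ∈ Icc 0 T → r ∈ Icc 0 T →
      ‖Φ r p - Φ s p‖ ≤ C * |r - s| := fun p s r hs hr =>
    (convex_Icc 0 T).norm_image_sub_le_of_norm_hasDerivWithin_le (hΦ p).2
      (fun _ _ => hC _) hs hr
  have h0T : (0 : ℝ) ∈ Icc 0 T := left_mem_Icc.2 hT
  rcases le_or_gt δ t with hδt | hδt
  -- There is time for the curve from `y` to reach the height of `z`; from then on the two are
  -- compared by Grönwall over time `t - δ`.
  · have hδT : δ ∈ Icc 0 T := ⟨hδ0, hδt.trans ht.2⟩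
    have hS : t - δ ∈ Icc 0 T := ⟨by linarith, by linarith [ht.2]⟩
    have hτ : tauPart (Φ δ y) = tauPart z := by
      rw [tauPart_eq_of_curve (hΦ y).2 hδT, (hΦ y).1]; linarith
    have h1 := norm_sub_le_exp_of_curves hσ (S := t - δ)
      (hΦ.hasDerivWithinAt_shift y hδ0 (by linarith [ht.2]))
      (hΦ.hasDerivWithinAt_restrict z hS.2) (by rw [add_zero, hτ, (hΦ z).1])
      (fun s hs => by
        rw [add_zero, hτ]
        exact hz _ ⟨by linarith [hs.1], by linarith [hs.2, ht.2]⟩) (right_mem_Icc.2 hS.1)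
    simp only [add_zero, add_sub_cancel, (hΦ z).1] at h1
    have h2 : ‖Φ δ y - z‖ ≤ (1 + C) * ‖y - z‖ := by
      have h3 := hmove y h0T hδT
      rw [(hΦ y).1, sub_zero, abs_of_nonneg hδ0] at h3
      have h4 := norm_sub_le_norm_sub_add_norm_sub (Φ δ y) y z
      nlinarith
    have h3 : ‖Φ t y - Φ (t - δ) z‖ ≤ (1 + C) * ‖y - z‖ * Real.exp (K * B * T) := by
      refine h1.trans ?_
      have := hS.2
      gcongr
    -- The curve from `z` was stopped `δ` too early; this accounts for the final summand `C` in the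
    -- constant.
    have h4 := hmove z ht hS
    rw [show t - δ - t = -δ by ring, abs_neg, abs_of_nonneg hδ0] at h4
    have h5 := norm_sub_le_norm_sub_add_norm_sub (Φ t y) (Φ (t - δ) z) (Φ t z)
    nlinarith
  -- Here `t < δ ≤ ‖y - z‖`, so both displacements are themselves of order `‖y - z‖`.
  · have h1 := hmove y h0T ht
    have h2 := hmove z h0T ht
    rw [(hΦ _).1, sub_zero, abs_of_nonneg ht.1] at h1 h2
    have h3 := norm_sub_le_norm_sub_add_norm_sub (Φ t y) y (Φ t z)
    have h4 := norm_sub_le_norm_sub_add_norm_sub y z (Φ t z)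
    rw [norm_sub_rev z] at h4
    have h5 : C * t ≤ C * ‖y - z‖ := by gcongr; linarith
    have h6 : (1 + C) * ‖y - z‖ * 1 ≤ (1 + C) * ‖y - z‖ * Real.exp (K * B * T) := by gcongr
    nlinarith

lemma IsCharFlow.exists_lipschitz (hΦ : IsCharFlow σ w b T Φ) (hσ : ∃ K : ℝ≥0, LipschitzWith K σ)
    (hw : ∃ K : ℝ≥0, LipschitzWith K w) {C : ℝ} (hC : ∀ z, ‖fieldG σ w b z‖ ≤ C) {A : Set ℝ}
    (hA : ∃ B : ℝ, ∀ τ ∈ A, ‖w τ‖ ≤ B) :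
    ∃ L : ℝ≥0, ∀ t ∈ Icc 0 T, ∀ y z : Phase d, tauPart y ∈ A → tauPart z ∈ A →
      ‖Φ t y - Φ t z‖ ≤ L * ‖y - z‖ := by
  obtain ⟨K, hσ⟩ := hσ
  obtain ⟨Kw, hw⟩ := hw
  obtain ⟨B, hB⟩ := hA
  have hB' : ∀ τ ∈ A, ∀ r ∈ Icc τ (τ + T), ‖w r‖ ≤ (B + Kw * T).toNNReal := by
    intro τ hτ r hr
    refine le_trans ?_ (Real.le_coe_toNNReal _)
    have h1 := hw.norm_sub_le r τ
    have h2 : ‖r - τ‖ ≤ T := by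
      rw [Real.norm_eq_abs, abs_of_nonneg (by linarith [hr.1])]; linarith [hr.2]
    have h3 : (Kw : ℝ) * ‖r - τ‖ ≤ Kw * T := by gcongr
    linarith [norm_le_insert' (w r) (w τ), hB τ hτ]
  refine ⟨((1 + C) * Real.exp (K * (B + Kw * T).toNNReal * T) + C).toNNReal,
    fun t ht y z hy hz => ?_⟩
  refine (hΦ.norm_sub_le hσ hC (hB' _ hy) (hB' _ hz) ht).trans ?_
  gcongr
  exact Real.le_coe_toNNReal _

lemma IsCharFlow.isBoundedFlow (hΦ : IsCharFlow σ w b T Φ)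
    (hσ : ∃ K : ℝ≥0, LipschitzWith K σ) (hw : ∃ K : ℝ≥0, LipschitzWith K w) (hb : Continuous b)
    {C : ℝ} (hC : ∀ z, ‖fieldG σ w b z‖ ≤ C) : IsBoundedFlow (fieldG σ w b) T C Φ where
  continuous_field := continuous_fieldG hσ.choose_spec.continuous hw.choose_spec.continuous hb
  norm_field_le := hC
  zero z := (hΦ z).1
  hasDerivWithinAt z := (hΦ z).2
  add z u h hu hh huh := by
    have := eqOn_of_curves hσ hw.choose_spec.continuous (S := u)
      (hΦ.hasDerivWithinAt_shift z hh (by linarith))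
      (hΦ.hasDerivWithinAt_restrict (Φ h z) (by linarith)) (by simp [(hΦ _).1])
      (right_mem_Icc.2 hu)
    rwa [add_comm] at this
  lipschitzOnWith R := by
    obtain ⟨B, hB⟩ := exists_norm_le_of_continuous hw.choose_spec.continuous (-R) R
    obtain ⟨L, hL⟩ := hΦ.exists_lipschitz hσ hw hC (A := Icc (-R) R) ⟨B, hB⟩
    have hmem : ∀ y ∈ Metric.closedBall (0 : Phase d) R, tauPart y ∈ Icc (-R) R := fun y hy =>
      abs_le.1 ((abs_tauPart_le y).trans (mem_closedBall_zero_iff.1 hy))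
    refine ⟨L, fun t ht => LipschitzOnWith.of_dist_le_mul fun y hy z hz => ?_⟩
    rw [dist_eq_norm, dist_eq_norm]
    exact hL t ht y z (hmem y hy) (hmem z hz)

end CharFlow

/-! ### Transport plans and the Wasserstein distance -/

section Plans

variable {E : Type*} [MeasurableSpace E] {μ ν : Measure E}

lemma ae_fst_of_plan {π : Measure (E × E)} (hπ : π ∈ transportPlans μ ν) {P : E → Prop}
    (hP : ∀ᵐ z ∂μ, P z) : ∀ᵐ p ∂π, P p.1 :=
  ae_of_ae_map measurable_fst.aemeasurable (by rwa [hπ.1])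

lemma ae_snd_of_plan {π : Measure (E × E)} (hπ : π ∈ transportPlans μ ν) {P : E → Prop}
    (hP : ∀ᵐ z ∂ν, P z) : ∀ᵐ p ∂π, P p.2 :=
  ae_of_ae_map measurable_snd.aemeasurable (by rwa [hπ.2])

lemma isProbabilityMeasure_of_plan {π : Measure (E × E)} (hπ : π ∈ transportPlans μ ν)
    [hμ : IsProbabilityMeasure μ] : IsProbabilityMeasure π := by
  have h := hμ.measure_univ
  rw [← hπ.1, Measure.map_apply measurable_fst .univ, preimage_univ] at h
  exact ⟨h⟩

end Plans

section Wasserstein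

variable {E : Type*} [NormedAddCommGroup E] [MeasurableSpace E] {μ ν : Measure E}

lemma wass1_le_of_plan {π : Measure (E × E)} (hπ : π ∈ transportPlans μ ν) :
    wass1 μ ν ≤ ∫⁻ p, ‖p.1 - p.2‖ₑ ∂π := iInf₂_le π hπ

lemma exists_plan_of_wass1_lt {c : ℝ≥0∞} (h : wass1 μ ν < c) :
    ∃ π ∈ transportPlans μ ν, ∫⁻ p, ‖p.1 - p.2‖ₑ ∂π < c := by
  simpa [wass1, iInf_lt_iff] using h

variable [BorelSpace E] [SecondCountableTopology E]

lemma wass1_map_map_le {α : Type*} [MeasurableSpace α] (μ : Measure α) {f g : α → E}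
    (hf : Measurable f) (hg : Measurable g) :
    wass1 (μ.map f) (μ.map g) ≤ ∫⁻ z, ‖f z - g z‖ₑ ∂μ := by
  refine (wass1_le_of_plan (π := μ.map fun z => (f z, g z)) ⟨?_, ?_⟩).trans_eq ?_
  · rw [Measure.map_map measurable_fst (hf.prodMk hg)]; rfl
  · rw [Measure.map_map measurable_snd (hf.prodMk hg)]; rfl
  · exact lintegral_map (by fun_prop) (hf.prodMk hg)

lemma wass1_map_le_of_plan {π : Measure (E × E)} (hπ : π ∈ transportPlans μ ν) {f : E → E}
    (hf : Measurable f) :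
    wass1 (μ.map f) (ν.map f) ≤ ∫⁻ p, ‖f p.1 - f p.2‖ₑ ∂π := by
  rw [← hπ.1, ← hπ.2, Measure.map_map hf measurable_fst, Measure.map_map hf measurable_snd]
  exact wass1_map_map_le π (hf.comp measurable_fst) (hf.comp measurable_snd)

/-- Every plan is pushed forward by `f` in both components. `L ≠ 0` matters because `wass1` is `⊤`
when there is no plan, and `0 * ⊤ = 0`. -/
lemma wass1_map_le_mul {f : E → E} (hf : Measurable f) {L : ℝ≥0} (hL : L ≠ 0) {S : Set E}
    (hμ : ∀ᵐ z ∂μ, z ∈ S) (hν : ∀ᵐ z ∂ν, z ∈ S)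
    (h : ∀ y ∈ S, ∀ z ∈ S, ‖f y - f z‖ ≤ L * ‖y - z‖) :
    wass1 (μ.map f) (ν.map f) ≤ L * wass1 μ ν := by
  have hL' : (L : ℝ≥0∞) ≠ 0 := by simpa using hL
  rw [mul_comm, ← ENNReal.div_le_iff hL' ENNReal.coe_ne_top]
  refine le_iInf₂ fun π hπ => ?_
  rw [ENNReal.div_le_iff hL' ENNReal.coe_ne_top, mul_comm]
  refine (wass1_map_le_of_plan hπ hf).trans ?_
  rw [← lintegral_const_mul' _ _ ENNReal.coe_ne_top]
  refine lintegral_mono_ae ?_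
  filter_upwards [ae_fst_of_plan hπ hμ, ae_snd_of_plan hπ hν] with p h1 h2
  have h3 := h _ h1 _ h2
  rw [← ofReal_norm, ← ofReal_norm, ← ENNReal.ofReal_coe_nnreal,
    ← ENNReal.ofReal_mul L.coe_nonneg]
  exact ENNReal.ofReal_le_ofReal h3

/-- Integrals of bounded uniformly continuous functions are continuous for `wass1`. -/
lemma tendsto_integral_of_wass1 {ι : Type*} {l : Filter ι} {F : ι → Measure E}
    (hF : ∀ᶠ i in l, IsProbabilityMeasure (F i)) [IsProbabilityMeasure μ]
    (h : Tendsto (fun i => wass1 (F i) μ) l (𝓝 0)) {ψ : E → ℝ} (hψ : UniformContinuous ψ)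
    {M : ℝ} (hM : ∀ z, |ψ z| ≤ M) :
    Tendsto (fun i => ∫ z, ψ z ∂(F i)) l (𝓝 (∫ z, ψ z ∂μ)) := by
  have hM0 : 0 ≤ M := (abs_nonneg _).trans (hM 0)
  rw [Metric.tendsto_nhds]
  intro ε hε
  obtain ⟨δ, hδ, hδψ⟩ := Metric.uniformContinuous_iff.1 hψ (ε / 2) (by linarith)
  -- A bounded uniformly continuous function has an affine modulus, which can be integrated against
  -- a plan.
  have hkey : ∀ y z, |ψ y - ψ z| ≤ ε / 2 + 2 * M / δ * ‖y - z‖ := by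
    intro y z
    rcases lt_or_ge ‖y - z‖ δ with hlt | hge
    · have := hδψ (dist_eq_norm y z ▸ hlt)
      rw [Real.dist_eq] at this
      have : 0 ≤ 2 * M / δ * ‖y - z‖ := by positivity
      linarith
    · have h1 : |ψ y - ψ z| ≤ 2 * M := by
        linarith [abs_sub (ψ y) (ψ z), hM y, hM z]
      have h2 : 2 * M ≤ 2 * M / δ * ‖y - z‖ := by
        rw [div_mul_eq_mul_div, le_div_iff₀ hδ]; gcongr
      linarith
  obtain ⟨c, hc0, hc⟩ : ∃ c : ℝ, 0 < c ∧ 2 * M / δ * c < ε / 2 := by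
    refine ⟨ε / 2 / (2 * M / δ + 1), by positivity, ?_⟩
    rw [← mul_div_assoc, div_lt_iff₀ (by positivity)]
    nlinarith [show 0 ≤ 2 * M / δ by positivity]
  filter_upwards [hF, h.eventually_lt_const (ENNReal.ofReal_pos.2 hc0)] with i hi hlt
  obtain ⟨π, hπ, hcost⟩ := exists_plan_of_wass1_lt hlt
  have := isProbabilityMeasure_of_plan hπ
  have hint : ∀ {f : E × E → ℝ}, Continuous f → (∀ p, |f p| ≤ M) → Integrable f π := fun hf hb =>
    Integrable.of_bound hf.aestronglyMeasurable M (Eventually.of_forall hb)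
  have hnorm : Integrable (fun p : E × E => ‖p.1 - p.2‖) π := by
    refine ⟨by fun_prop, ?_⟩
    simpa [HasFiniteIntegral] using hcost.trans ENNReal.ofReal_lt_top
  have hcost' : ∫ p, ‖p.1 - p.2‖ ∂π ≤ c := by
    rw [integral_eq_lintegral_of_nonneg_ae (Eventually.of_forall fun _ => norm_nonneg _)
      hnorm.aestronglyMeasurable]
    refine ENNReal.toReal_le_of_le_ofReal hc0.le ?_
    simpa using hcost.le
  have e1 : ∫ z, ψ z ∂(F i) = ∫ p, ψ p.1 ∂π := by
    rw [← hπ.1, integral_map measurable_fst.aemeasurable hψ.continuous.aestronglyMeasurable]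
  have e2 : ∫ z, ψ z ∂μ = ∫ p, ψ p.2 ∂π := by
    rw [← hπ.2, integral_map measurable_snd.aemeasurable hψ.continuous.aestronglyMeasurable]
  have i1 : Integrable (fun p : E × E => ψ p.1) π :=
    hint (hψ.continuous.comp continuous_fst) fun p => hM p.1
  have i2 : Integrable (fun p : E × E => ψ p.2) π :=
    hint (hψ.continuous.comp continuous_snd) fun p => hM p.2
  have i3 : Integrable (fun p : E × E => ε / 2 + 2 * M / δ * ‖p.1 - p.2‖) π :=
    (integrable_const _).add (hnorm.const_mul _)
  rw [Real.dist_eq, e1, e2, ← integral_sub i1 i2]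
  rw [← Real.norm_eq_abs]
  calc ‖∫ p, (ψ p.1 - ψ p.2) ∂π‖ ≤ ∫ p, (ε / 2 + 2 * M / δ * ‖p.1 - p.2‖) ∂π :=
        norm_integral_le_of_norm_le i3 (Eventually.of_forall fun p => hkey _ _)
    _ = ε / 2 + 2 * M / δ * ∫ p, ‖p.1 - p.2‖ ∂π := by
        rw [integral_add (integrable_const _) (hnorm.const_mul _), integral_const_mul]; simp
    _ ≤ ε / 2 + 2 * M / δ * c := by gcongr
    _ < ε := by linarith

end Wasserstein

lemma abs_integral_sub_le {α : Type*} [MeasurableSpace α] {f g : α → ℝ} {μ : Measure α} [IsProbabilityMeasure μ]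
    (hf : Integrable f μ) (hg : Integrable g μ) {c : ℝ} (h : ∀ z, |f z - g z| ≤ c) :
    |∫ z, f z ∂μ - ∫ z, g z ∂μ| ≤ c := by
  rw [← integral_sub hf hg]
  simpa using! norm_integral_le_of_norm_le_const (f := fun z => f z - g z) (μ := μ)
    (Eventually.of_forall h)

/-! ### Mollification and Taylor expansion -/

section Mollify

variable {E : Type*} [NormedAddCommGroup E] [NormedSpace ℝ E] [FiniteDimensional ℝ E]
  [MeasurableSpace E] [BorelSpace E]

/-- The convolution of `f` with the normalized bump function `ρ`. -/
noncomputable def mollify (ρ : ContDiffBump (0 : E)) (f : E → ℝ) (z : E) : ℝ :=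
  ∫ v, ρ.normed Measure.addHaar v * f (z - v) ∂Measure.addHaar

open scoped Convolution in
lemma mollify_eq_convolution (ρ : ContDiffBump (0 : E)) (f : E → ℝ) :
    mollify ρ f = ρ.normed Measure.addHaar ⋆[ContinuousLinearMap.lsmul ℝ ℝ, Measure.addHaar] f :=
  rfl

lemma contDiff_mollify (ρ : ContDiffBump (0 : E)) {f : E → ℝ} (hf : Continuous f) :
    ContDiff ℝ ∞ (mollify ρ f) := by
  rw [mollify_eq_convolution]
  exact (ρ.hasCompactSupport_normed).contDiff_convolution_left _ ρ.contDiff_normed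
    hf.locallyIntegrable

lemma hasCompactSupport_mollify (ρ : ContDiffBump (0 : E)) {f : E → ℝ}
    (hf : HasCompactSupport f) : HasCompactSupport (mollify ρ f) := by
  rw [mollify_eq_convolution]
  exact ρ.hasCompactSupport_normed.convolution _ hf

lemma integrable_mollify_integrand (ρ : ContDiffBump (0 : E)) {f : E → ℝ} (hf : Continuous f)
    (z : E) : Integrable (fun v => ρ.normed Measure.addHaar v * f (z - v)) Measure.addHaar :=
  Continuous.integrable_of_hasCompactSupport
    (ρ.continuous_normed.mul (hf.comp (continuous_const.sub continuous_id)))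
    ρ.hasCompactSupport_normed.mul_right

/-- Both sides average against the same probability density, so a bound on its support survives.
Allowing different functions and base points lets this compare a mollified function with a translate
of another. -/
lemma abs_mollify_sub_le (ρ : ContDiffBump (0 : E)) {f g : E → ℝ} (hf : Continuous f)
    (hg : Continuous g) {y z : E} {c : ℝ}
    (h : ∀ v, ‖v‖ < ρ.rOut → |f (y - v) - g (z - v)| ≤ c) :
    |mollify ρ f y - mollify ρ g z| ≤ c := by
  unfold mollify
  rw [← integral_sub (integrable_mollify_integrand ρ hf y) (integrable_mollify_integrand ρ hg z)]
  have hc : ∫ v, ρ.normed (Measure.addHaar : Measure E) v * c ∂Measure.addHaar = c := by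
    rw [integral_mul_const, ρ.integral_normed, one_mul]
  have hi : Integrable (ρ.normed (Measure.addHaar : Measure E)) Measure.addHaar :=
    ρ.continuous_normed.integrable_of_hasCompactSupport ρ.hasCompactSupport_normed
  rw [← Real.norm_eq_abs]
  refine (norm_integral_le_of_norm_le (hi.mul_const c)
    (Eventually.of_forall fun v => ?_)).trans_eq hc
  rw [← mul_sub, norm_mul, Real.norm_of_nonneg (ρ.nonneg_normed v)]
  by_cases hv : ‖v‖ < ρ.rOut
  · exact mul_le_mul_of_nonneg_left (h v hv) (ρ.nonneg_normed v)
  · have : ρ.normed (Measure.addHaar : Measure E) v = 0 := by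
      rw [← Function.notMem_support, ρ.support_normed_eq]; simpa using hv
    simp [this]

lemma abs_mollify_sub_self_le (ρ : ContDiffBump (0 : E)) {f : E → ℝ} (hf : Continuous f)
    {z : E} {c : ℝ} (h : ∀ y, ‖y - z‖ < ρ.rOut → |f y - f z| ≤ c) : |mollify ρ f z - f z| ≤ c := by
  have hconst : mollify ρ (fun _ => f z) z = f z := by
    unfold mollify
    rw [integral_mul_const, ρ.integral_normed, one_mul]
  have := abs_mollify_sub_le ρ hf (continuous_const (y := f z)) (y := z) (z := z) (c := c)
    fun v hv => h _ (by simpa using hv)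
  rwa [hconst] at this

/-- A bump function centered at `0` with support of radius `ε`. -/
noncomputable def bumpOfRadius {ε : ℝ} (hε : 0 < ε) : ContDiffBump (0 : E) :=
  ⟨ε / 2, ε, half_pos hε, half_lt_self hε⟩

lemma exists_abs_mollify_sub_le {f : E → ℝ} (hf : Continuous f) (hc : HasCompactSupport f)
    {η : ℝ} (hη : 0 < η) :
    ∃ ε > 0, ∀ ρ : ContDiffBump (0 : E), ρ.rOut ≤ ε → ∀ z, |mollify ρ f z - f z| ≤ η := by
  obtain ⟨ε, hε, h⟩ := Metric.uniformContinuous_iff.1 (hc.uniformContinuous_of_continuous hf) η hη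
  refine ⟨ε, hε, fun ρ hρ z => abs_mollify_sub_self_le ρ hf fun y hy => ?_⟩
  exact (h (dist_eq_norm y z ▸ hy.trans_le hρ)).le

lemma Continuous.integrable_of_compactSupport {f : E → ℝ} (hf : Continuous f)
    (hc : HasCompactSupport f) (μ : Measure E) [IsFiniteMeasure μ] : Integrable f μ :=
  hf.integrable_of_hasCompactSupport hc

lemma exists_abs_integral_mollify_sub_le {f : E → ℝ} (hf : Continuous f)
    (hc : HasCompactSupport f) {η : ℝ} (hη : 0 < η) :
    ∃ ε > 0, ∀ ρ : ContDiffBump (0 : E), ρ.rOut ≤ ε → ∀ μ : Measure E, IsProbabilityMeasure μ →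
      |∫ z, mollify ρ f z ∂μ - ∫ z, f z ∂μ| ≤ η := by
  obtain ⟨ε, hε, h⟩ := exists_abs_mollify_sub_le hf hc hη
  refine ⟨ε, hε, fun ρ hρ μ hμ => abs_integral_sub_le ?_ ?_ (h ρ hρ)⟩
  · exact (contDiff_mollify ρ hf).continuous.integrable_of_compactSupport
      (hasCompactSupport_mollify ρ hc) μ
  · exact hf.integrable_of_compactSupport hc μ

/-- Probability measures are determined by their integrals of smooth compactly supported
functions. -/
lemma ext_of_integral_smooth {μ ν : Measure E} [IsProbabilityMeasure μ] [IsProbabilityMeasure ν]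
    (h : ∀ φ : E → ℝ, ContDiff ℝ ∞ φ → HasCompactSupport φ → ∫ z, φ z ∂μ = ∫ z, φ z ∂ν) :
    μ = ν := by
  refine Measure.ext_of_integral_eq_on_compactlySupported fun f => ?_
  refine eq_of_forall_dist_le fun η hη => ?_
  obtain ⟨ε, hε, hρ⟩ := exists_abs_integral_mollify_sub_le f.continuous f.hasCompactSupport
    (half_pos hη)
  have h1 := hρ (bumpOfRadius hε) le_rfl μ ‹_›
  have h2 := hρ (bumpOfRadius hε) le_rfl ν ‹_›
  rw [h _ (contDiff_mollify _ f.continuous) (hasCompactSupport_mollify _ f.hasCompactSupport)] at h1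
  have h3 := dist_triangle_left (∫ z, f z ∂μ) (∫ z, f z ∂ν)
    (∫ z, mollify (bumpOfRadius hε) f z ∂ν)
  exact h3.trans ((add_le_add h1 h2).trans_eq (add_halves η))

end Mollify

section Taylor

variable {E : Type*} [NormedAddCommGroup E] [NormedSpace ℝ E]

/-- First-order Taylor expansion, uniformly in the base point. -/
lemma exists_abs_sub_fderiv_le {χ : E → ℝ} (hχ : ContDiff ℝ ∞ χ) (hc : HasCompactSupport χ)
    {η : ℝ} (hη : 0 < η) :
    ∃ δ > 0, ∀ z v, ‖v‖ < δ → |χ (z + v) - χ z - fderiv ℝ χ z v| ≤ η * ‖v‖ := by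
  obtain ⟨δ, hδ, h⟩ := Metric.uniformContinuous_iff.1
    ((hc.fderiv ℝ).uniformContinuous_of_continuous (hχ.continuous_fderiv (by simp))) η hη
  refine ⟨δ, hδ, fun z v hv => ?_⟩
  have := (convex_ball z δ).norm_image_sub_le_of_norm_fderiv_le' (f := χ) (C := η)
    (φ := fderiv ℝ χ z) (x := z) (y := z + v) (𝕜 := ℝ)
    (fun x _ => (hχ.differentiable (by simp)).differentiableAt)
    (fun x hx => by rw [← dist_eq_norm]; exact (h hx).le) (Metric.mem_ball_self hδ)
    (by simpa using hv)
  simpa using! this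

end Taylor

/-! ### Uniqueness of weak solutions by duality -/

section Uniqueness

variable {E : Type*} [NormedAddCommGroup E] [NormedSpace ℝ E] {G : E → E} {T C : ℝ}
  {Φ : ℝ → E → E}

/-- The mean value inequality for `Φ r p - r • G z`. The field is frozen at `z` rather than at `p`
because in the convolution `p` varies while `z` is fixed. -/
lemma IsBoundedFlow.norm_sub_euler_le (hΦ : IsBoundedFlow G T C Φ) {p z : E} {h c : ℝ}
    (hh : h ∈ Icc 0 T) (hc : ∀ r ∈ Icc 0 h, ‖G (Φ r p) - G z‖ ≤ c) :
    ‖Φ h p - (p + h • G z)‖ ≤ c * h := by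
  have hd : ∀ r ∈ Icc 0 h, HasDerivWithinAt (fun r => Φ r p - r • G z) (G (Φ r p) - G z)
      (Icc 0 h) r := fun r hr => by
    have h1 := (hΦ.hasDerivWithinAt p r ⟨hr.1, hr.2.trans hh.2⟩).mono (Icc_subset_Icc_right hh.2)
    simpa using! h1.sub ((hasDerivWithinAt_id r (Icc 0 h)).smul_const (G z))
  have := (convex_Icc 0 h).norm_image_sub_le_of_norm_hasDerivWithin_le hd hc
    (left_mem_Icc.2 hh.1) (right_mem_Icc.2 hh.1)
  simp only [hΦ.zero, zero_smul, sub_zero, Real.norm_of_nonneg hh.1] at this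
  rwa [← sub_sub, sub_right_comm]

variable [FiniteDimensional ℝ E]

lemma IsBoundedFlow.hasCompactSupport_comp (hΦ : IsBoundedFlow G T C Φ) {φ : E → ℝ}
    (hc : HasCompactSupport φ) {t : ℝ} (ht : t ∈ Icc 0 T) :
    HasCompactSupport (fun z => φ (Φ t z)) := by
  obtain ⟨R, hR⟩ := hc.isCompact.isBounded.subset_closedBall 0
  refine HasCompactSupport.of_support_subset_isCompact
    (isCompact_closedBall (0 : E) (R + C * T)) fun z hz => ?_
  have h1 := mem_closedBall_zero_iff.1 (hR (subset_tsupport _ hz))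
  have h2 := hΦ.norm_sub_self_le z ht
  have h3 : C * t ≤ C * T := mul_le_mul_of_nonneg_left ht.2 hΦ.bound_nonneg
  rw [mem_closedBall_zero_iff]
  linarith [norm_le_insert (Φ t z) z]

/-- Along the flow, `φ ∘ Φ_{u + h}` is to first order the translate of `φ ∘ Φ_u` in the direction of
a nearby value of the field. -/
lemma IsBoundedFlow.exists_abs_comp_sub_le (hΦ : IsBoundedFlow G T C Φ) {φ : E → ℝ} {Lφ : ℝ≥0}
    (hφ : LipschitzWith Lφ φ) (hc : HasCompactSupport φ) {η : ℝ} (hη : 0 < η) :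
    ∃ ε > 0, ∃ h₀ > 0, ∀ u h, 0 ≤ u → 0 ≤ h → h ≤ h₀ → u + h ≤ T → ∀ p z, ‖p - z‖ ≤ ε →
      |φ (Φ (u + h) p) - φ (Φ u (p + h • G z))| ≤ η * h := by
  obtain ⟨R, hR⟩ := hc.isCompact.isBounded.subset_closedBall 0
  have hsupp : ∀ z, φ z ≠ 0 → ‖z‖ ≤ R := fun z hz =>
    mem_closedBall_zero_iff.1 (hR (subset_tsupport _ hz))
  have hC := hΦ.bound_nonneg
  -- If `‖p‖ ≤ R + 2CT`, all points below stay in this ball; otherwise neither argument reaches the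
  -- support of `φ` and both terms vanish.
  obtain ⟨L, hL⟩ := hΦ.lipschitzOnWith (R + 3 * (C * T) + 1)
  have hG : UniformContinuousOn G (Metric.closedBall 0 (R + 3 * (C * T) + 1)) :=
    (isCompact_closedBall _ _).uniformContinuousOn_of_continuous hΦ.continuous_field.continuousOn
  obtain ⟨δ, hδ, hGδ⟩ := Metric.uniformContinuousOn_iff.1 hG (η / (Lφ * L + 1)) (by positivity)
  -- The offset `‖p - z‖` and the displacement `C * h` are each at most `δ / 4`, so the curve stays
  -- `δ`-close to `z`.
  refine ⟨min (δ / 4) 1, by positivity, δ / (4 * (C + 1)), by positivity, ?_⟩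
  intro u h hu hh hh0 huh p z hpz
  have hpz1 : ‖p - z‖ ≤ 1 := hpz.trans (min_le_right _ _)
  have hpzδ : ‖p - z‖ ≤ δ / 4 := hpz.trans (min_le_left _ _)
  have huT : u ∈ Icc 0 T := ⟨hu, by linarith⟩
  have hhT : h ∈ Icc 0 T := ⟨hh, by linarith⟩
  have hCh : C * h ≤ δ / 4 := by
    rw [le_div_iff₀ (by positivity)] at hh0
    nlinarith
  have hCT : ∀ {s}, s ≤ T → C * s ≤ C * T := fun hs => mul_le_mul_of_nonneg_left hs hC
  have hp1 := hΦ.norm_sub_self_le p hhT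
  have hp2 : ‖h • G z‖ ≤ C * h := by
    rw [norm_smul, Real.norm_of_nonneg hh, mul_comm]
    exact mul_le_mul_of_nonneg_right (hΦ.norm_field_le z) hh
  rw [hΦ.add p u h hu hh huh]
  by_cases hp : ‖p‖ ≤ R + 2 * (C * T)
  · have hball : ∀ r ∈ Icc 0 h, Φ r p ∈ Metric.closedBall (0 : E) (R + 3 * (C * T) + 1) := by
      intro r hr
      have h1 := hΦ.norm_sub_self_le p ⟨hr.1, hr.2.trans hhT.2⟩
      rw [mem_closedBall_zero_iff]
      linarith [norm_le_insert' (Φ r p) p, hCT (hr.2.trans hhT.2)]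
    have hz : z ∈ Metric.closedBall (0 : E) (R + 3 * (C * T) + 1) := by
      rw [mem_closedBall_zero_iff]
      have : 0 ≤ C * T := mul_nonneg hC (hh.trans hhT.2)
      linarith [norm_le_insert p z]
    have hq : p + h • G z ∈ Metric.closedBall (0 : E) (R + 3 * (C * T) + 1) := by
      rw [mem_closedBall_zero_iff]
      linarith [norm_add_le p (h • G z), hCT hhT.2]
    have heuler := hΦ.norm_sub_euler_le (p := p) (z := z) (c := η / (Lφ * L + 1)) hhT
      fun r hr => by
        rw [← dist_eq_norm]
        refine (hGδ _ (hball r hr) _ hz ?_).le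
        have h1 := hΦ.norm_sub_self_le p ⟨hr.1, hr.2.trans hhT.2⟩
        have h2 : C * r ≤ C * h := mul_le_mul_of_nonneg_left hr.2 hC
        rw [dist_eq_norm]
        linarith [norm_sub_le_norm_sub_add_norm_sub (Φ r p) p z]
    calc |φ (Φ u (Φ h p)) - φ (Φ u (p + h • G z))|
        ≤ Lφ * (L * ‖Φ h p - (p + h • G z)‖) := by
          refine (hφ.norm_sub_le _ _).trans ?_
          gcongr
          exact (hL u huT).norm_sub_le (hball h (right_mem_Icc.2 hh)) hq
      _ ≤ Lφ * (L * (η / (Lφ * L + 1) * h)) := by gcongr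
      _ = (Lφ * L / (Lφ * L + 1)) * (η * h) := by ring
      _ ≤ 1 * (η * h) := by
          gcongr
          rw [div_le_one (by positivity)]
          linarith
      _ = η * h := one_mul _
  · have hzero : ∀ q, ‖p - q‖ ≤ C * h → φ (Φ u q) = 0 := by
      intro q hq
      by_contra hne
      have h1 := hsupp _ hne
      have h2 := hΦ.norm_sub_self_le q huT
      apply hp
      linarith [norm_le_insert (Φ u q) q, norm_le_insert' p q, hCT huT.2, hCT hhT.2]
    rw [hzero _ (by rwa [norm_sub_rev]), hzero _ (by simpa using hp2)]
    simp only [sub_self, abs_zero]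
    positivity

end Uniqueness

section WeakUniqueness

variable {E : Type*} [NormedAddCommGroup E] [NormedSpace ℝ E] [FiniteDimensional ℝ E]
  [MeasurableSpace E] [BorelSpace E] {G : E → E} {T C : ℝ} {Φ : ℝ → E → E}
  {F : ℝ → Measure E} {F₀ : Measure E}

lemma IsContinuousCurve.continuousOn_integral (hF : IsContinuousCurve T F) {ψ : E → ℝ}
    (hψ : Continuous ψ) (hc : HasCompactSupport ψ) :
    ContinuousOn (fun s => ∫ z, ψ z ∂(F s)) (Icc 0 T) := by
  intro t ht
  obtain ⟨M, hM⟩ := hψ.bounded_above_of_compact_support hc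
  have := (hF.1 t ht).1
  exact tendsto_integral_of_wass1
    (eventually_nhdsWithin_of_forall fun s hs => (hF.1 s hs).1) (hF.2 t ht)
    (hc.uniformContinuous_of_continuous hψ) hM

/-- The weak form of the continuity equation `∂_t F + ∇ · (G F) = 0` on `[0,T]`. -/
def SatisfiesWeakForm (G : E → E) (T : ℝ) (F₀ : Measure E) (F : ℝ → Measure E) : Prop :=
  ∀ φ : E → ℝ, ContDiff ℝ ∞ φ → HasCompactSupport φ → ∀ t ∈ Icc 0 T,
    (∫ z, φ z ∂(F t)) = (∫ z, φ z ∂F₀) + ∫ s in (0 : ℝ)..t, (∫ z, fderiv ℝ φ z (G z) ∂(F s))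

omit [FiniteDimensional ℝ E] [MeasurableSpace E] [BorelSpace E] in
lemma continuous_fderiv_apply {φ : E → ℝ} (hφ : ContDiff ℝ ∞ φ) (hG : Continuous G) :
    Continuous fun z => fderiv ℝ φ z (G z) :=
  (hφ.continuous_fderiv (by simp)).clm_apply hG

omit [FiniteDimensional ℝ E] [MeasurableSpace E] [BorelSpace E] in
lemma hasCompactSupport_fderiv_apply {φ : E → ℝ} (hc : HasCompactSupport φ) :
    HasCompactSupport fun z => fderiv ℝ φ z (G z) :=
  (hc.fderiv ℝ).mono fun z hz => by
    contrapose! hz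
    simp only [Function.mem_support, ne_eq, not_not] at hz
    simp [hz]

lemma SatisfiesWeakForm.integral_sub (h : SatisfiesWeakForm G T F₀ F)
    (hF : IsContinuousCurve T F) (hG : Continuous G) {φ : E → ℝ} (hφ : ContDiff ℝ ∞ φ)
    (hc : HasCompactSupport φ) {s t : ℝ} (hs : s ∈ Icc 0 T) (ht : t ∈ Icc 0 T) :
    (∫ z, φ z ∂(F t)) - ∫ z, φ z ∂(F s) =
      ∫ r in s..t, (∫ z, fderiv ℝ φ z (G z) ∂(F r)) := by
  have hm := hF.continuousOn_integral (continuous_fderiv_apply hφ hG)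
    (hasCompactSupport_fderiv_apply hc)
  have hint : ∀ {t}, t ∈ Icc 0 T → IntervalIntegrable
      (fun r => ∫ z, fderiv ℝ φ z (G z) ∂(F r)) volume 0 t := fun ht =>
    (hm.mono (by rw [uIcc_of_le ht.1]; exact Icc_subset_Icc_right ht.2)).intervalIntegrable
  rw [h φ hφ hc t ht, h φ hφ hc s hs, add_sub_add_left_eq_sub,
    intervalIntegral.integral_interval_sub_left (hint ht) (hint hs)]

/-- The mollified dual solution: the flow composed test function integrated against `F`. -/
noncomputable def dualPairing (Φ : ℝ → E → E) (F : ℝ → Measure E) (φ : E → ℝ)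
    (ρ : ContDiffBump (0 : E)) (t u : ℝ) : ℝ :=
  ∫ z, mollify ρ (fun y => φ (Φ u y)) z ∂(F (t - u))

lemma IsBoundedFlow.integrable_mollify_comp (hΦ : IsBoundedFlow G T C Φ) {φ : E → ℝ}
    (hφ : Continuous φ) (hc : HasCompactSupport φ) (ρ : ContDiffBump (0 : E)) {u : ℝ}
    (hu : u ∈ Icc 0 T) (μ : Measure E) [IsFiniteMeasure μ] :
    Integrable (mollify ρ fun y => φ (Φ u y)) μ :=
  (contDiff_mollify ρ (hφ.comp (hΦ.continuous hu))).continuous.integrable_of_compactSupport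
    (hasCompactSupport_mollify ρ (hΦ.hasCompactSupport_comp hc hu)) μ

lemma IsBoundedFlow.continuousOn_dualPairing (hΦ : IsBoundedFlow G T C Φ)
    (hF : IsContinuousCurve T F) {φ : E → ℝ} {Lφ : ℝ≥0} (hφ : LipschitzWith Lφ φ)
    (hc : HasCompactSupport φ) (ρ : ContDiffBump (0 : E)) {t : ℝ} (ht : t ∈ Icc 0 T) :
    ContinuousOn (dualPairing Φ F φ ρ t) (Icc 0 t) := by
  intro u hu
  have hT : ∀ {v}, v ∈ Icc 0 t → v ∈ Icc 0 T := fun hv => ⟨hv.1, hv.2.trans ht.2⟩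
  have hT' : ∀ {v}, v ∈ Icc 0 t → t - v ∈ Icc 0 T := fun hv =>
    ⟨by linarith [hv.2], by linarith [hv.1, ht.2]⟩
  have h1 : Tendsto (fun v => ∫ z, mollify ρ (fun y => φ (Φ u y)) z ∂(F (t - v)))
      (𝓝[Icc 0 t] u) (𝓝 (dualPairing Φ F φ ρ t u)) :=
    ((hF.continuousOn_integral
      (contDiff_mollify ρ (hφ.continuous.comp (hΦ.continuous (hT hu)))).continuous
      (hasCompactSupport_mollify ρ (hΦ.hasCompactSupport_comp hc (hT hu)))).comp
      (continuous_const.sub continuous_id).continuousOn (fun v hv => hT' hv)) u hu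
  have h2 : Tendsto (fun v => dualPairing Φ F φ ρ t v -
      ∫ z, mollify ρ (fun y => φ (Φ u y)) z ∂(F (t - v))) (𝓝[Icc 0 t] u) (𝓝 0) := by
    -- The change of the integrand is bounded uniformly in space, hence independently of the measure
    -- it is integrated against.
    have h3 : Tendsto (fun v => Lφ * (C * |v - u|)) (𝓝[Icc 0 t] u) (𝓝 0) := by
      have : Continuous fun v : ℝ => Lφ * (C * |v - u|) := by fun_prop
      simpa using (this.tendsto u).mono_left nhdsWithin_le_nhds
    refine squeeze_zero_norm' (eventually_nhdsWithin_of_forall fun v hv => ?_) h3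
    have := (hF.1 _ (hT' hv)).1
    refine abs_integral_sub_le (hΦ.integrable_mollify_comp hφ.continuous hc ρ (hT hv) _)
      (hΦ.integrable_mollify_comp hφ.continuous hc ρ (hT hu) _) fun z => ?_
    refine abs_mollify_sub_le ρ (hφ.continuous.comp (hΦ.continuous (hT hv)))
      (hφ.continuous.comp (hΦ.continuous (hT hu))) fun y _ => ?_
    refine (hφ.norm_sub_le _ _).trans ?_
    gcongr
    exact hΦ.norm_sub_le _ (hT hu) (hT hv)
  simpa [ContinuousWithinAt] using h2.add h1

lemma abs_intervalIntegral_sub_mul_le {m : ℝ → ℝ} {a c η : ℝ} (hac : a ≤ c)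
    (hm : ContinuousOn m (Icc a c)) (h : ∀ r ∈ Icc a c, |m r - m a| ≤ η) :
    |(∫ r in a..c, m r) - (c - a) * m a| ≤ η * (c - a) := by
  have hi : IntervalIntegrable m volume a c :=
    (hm.mono (by rw [uIcc_of_le hac])).intervalIntegrable
  have := intervalIntegral.norm_integral_le_of_norm_le_const (a := a) (b := c) (C := η)
    (f := fun r => m r - m a) fun r hr => h r (by
      rw [uIoc_of_le hac] at hr; exact Ioc_subset_Icc_self hr)
  rw [intervalIntegral.integral_sub hi (by simp), abs_of_nonneg (sub_nonneg.2 hac)] at this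
  simpa using! this

/-- The mollified dual pairing is almost constant in `u`. -/
lemma IsBoundedFlow.eventually_abs_dualPairing_sub_le (hΦ : IsBoundedFlow G T C Φ)
    (hF : IsContinuousCurve T F) (hweak : SatisfiesWeakForm G T F₀ F) {φ : E → ℝ}
    (hφ : Continuous φ) (hc : HasCompactSupport φ) (ρ : ContDiffBump (0 : E))
    {η h₀ : ℝ} (hη : 0 < η) (hh₀ : 0 < h₀)
    (hρ : ∀ u h, 0 ≤ u → 0 ≤ h → h ≤ h₀ → u + h ≤ T → ∀ p z, ‖p - z‖ ≤ ρ.rOut →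
      |φ (Φ (u + h) p) - φ (Φ u (p + h • G z))| ≤ η * h)
    {t u : ℝ} (ht : t ∈ Icc 0 T) (hu : u ∈ Ico 0 t) :
    ∀ᶠ v in 𝓝[>] u, |dualPairing Φ F φ ρ t v - dualPairing Φ F φ ρ t u| ≤ 3 * η * (v - u) := by
  have huT : u ∈ Icc 0 T := ⟨hu.1, hu.2.le.trans ht.2⟩
  have hsT : t - u ∈ Icc 0 T := ⟨by linarith [hu.2], by linarith [hu.1, ht.2]⟩
  have hC := hΦ.bound_nonneg
  have hχ : Continuous fun y => φ (Φ u y) := hφ.comp (hΦ.continuous huT)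
  have hX := contDiff_mollify ρ hχ
  have hXc := hasCompactSupport_mollify ρ (hΦ.hasCompactSupport_comp hc huT)
  set X := mollify ρ fun y => φ (Φ u y)
  have hDc := continuous_fderiv_apply hX hΦ.continuous_field
  have hDs : HasCompactSupport fun z => fderiv ℝ X z (G z) := hasCompactSupport_fderiv_apply hXc
  have hm := hF.continuousOn_integral hDc hDs
  set m : ℝ → ℝ := fun s => ∫ z, fderiv ℝ X z (G z) ∂(F s)
  obtain ⟨δ, hδ, hTaylor⟩ := exists_abs_sub_fderiv_le hX hXc (η := η / (C + 1)) (by positivity)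
  obtain ⟨δ', hδ', hmδ⟩ := Metric.continuousWithinAt_iff.1 (hm _ hsT) (η / 2) (by positivity)
  have hlim : Tendsto (fun v : ℝ => v - u) (𝓝[>] u) (𝓝 0) := by
    have : Continuous fun v : ℝ => v - u := by fun_prop
    simpa using (this.tendsto u).mono_left nhdsWithin_le_nhds
  filter_upwards [self_mem_nhdsWithin, hlim.eventually_lt_const hh₀, hlim.eventually_lt_const hδ',
    hlim.eventually_lt_const (show 0 < δ / (C + 1) by positivity),
    mem_nhdsWithin_of_mem_nhds (Iio_mem_nhds hu.2)] with v hv h1 h2 h3 hvt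
  obtain ⟨h, hh⟩ : ∃ h, h = v - u := ⟨_, rfl⟩
  have hv' : v = u + h := by linarith
  rw [← hh] at h1 h2 h3 ⊢
  rw [lt_div_iff₀ (by positivity), mul_comm] at h3
  have hh0 : 0 < h := by rw [hh]; exact sub_pos.2 (mem_Ioi.1 hv)
  have hvt : v < t := hvt
  have hvT : v ∈ Icc 0 T := ⟨by linarith [hu.1], hvt.le.trans ht.2⟩
  have haT : t - v ∈ Icc 0 T := ⟨by linarith, by linarith [hvT.1, ht.2]⟩
  have hprob := (hF.1 _ haT).1
  have hpoint : ∀ z, |mollify ρ (fun y => φ (Φ v y)) z - (X z + h * fderiv ℝ X z (G z))| ≤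
      2 * (η * h) := by
    intro z
    -- With `z` fixed, `h • G z` is a constant translation and passes through the convolution; no
    -- derivative of `φ ∘ Φ_u` is needed.
    have e1 : |mollify ρ (fun y => φ (Φ v y)) z - X (z + h • G z)| ≤ η * h := by
      refine abs_mollify_sub_le ρ (hφ.comp (hΦ.continuous hvT)) hχ fun y hy => ?_
      have := hρ u h hu.1 hh0.le h1.le (by linarith [hvT.2]) (z - y) z (by simpa using hy.le)
      rwa [← hv', sub_add_eq_add_sub] at this
    have hG : ‖h • G z‖ ≤ (C + 1) * h := by
      rw [norm_smul, Real.norm_of_nonneg hh0.le, mul_comm]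
      gcongr
      linarith [hΦ.norm_field_le z]
    have e2 := hTaylor z (h • G z) (hG.trans_lt h3)
    have e3 : η / (C + 1) * ‖h • G z‖ ≤ η * h := by
      calc η / (C + 1) * ‖h • G z‖ ≤ η / (C + 1) * ((C + 1) * h) := by gcongr
        _ = η * h := by field_simp
    rw [map_smul, smul_eq_mul] at e2
    have e4 := abs_add_le (mollify ρ (fun y => φ (Φ v y)) z - X (z + h • G z))
      (X (z + h • G z) - X z - h * fderiv ℝ X z (G z))
    rw [show mollify ρ (fun y => φ (Φ v y)) z - (X z + h * fderiv ℝ X z (G z)) =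
      mollify ρ (fun y => φ (Φ v y)) z - X (z + h • G z) +
        (X (z + h • G z) - X z - h * fderiv ℝ X z (G z)) by ring]
    linarith
  have iX : Integrable X (F (t - v)) := hX.continuous.integrable_of_compactSupport hXc _
  have iD : Integrable (fun z => h * fderiv ℝ X z (G z)) (F (t - v)) :=
    (hDc.integrable_of_compactSupport hDs _).const_mul h
  have hA := abs_integral_sub_le (hΦ.integrable_mollify_comp hφ hc ρ hvT (F (t - v)))
    (g := fun z => X z + h * fderiv ℝ X z (G z)) (iX.add iD) hpoint
  rw [integral_add iX iD, integral_const_mul] at hA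
  have hB := hweak.integral_sub hF hΦ.continuous_field hX hXc haT hsT
  have hle : t - v ≤ t - u := by linarith
  have hclose : ∀ r ∈ Icc (t - v) (t - u), |m r - m (t - u)| ≤ η / 2 := fun r hr =>
    (hmδ ⟨haT.1.trans hr.1, hr.2.trans hsT.2⟩ (by
      rw [Real.dist_eq, abs_lt]; constructor <;> linarith [hr.1, hr.2])).le
  -- The weak form over `[t - v, t - u]` yields `h * m (t - v)` up to `η * h`, cancelling the Taylor
  -- term in `hA`. Continuity of `m` is known at `t - u`, whence two halves of `η`.
  have hD := abs_intervalIntegral_sub_mul_le hle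
    (hm.mono (Icc_subset_Icc haT.1 hsT.2)) (η := η) fun r hr => by
      have e1 := hclose r hr
      have e2 := hclose _ (left_mem_Icc.2 hle)
      rw [abs_le] at *
      constructor <;> linarith [e1.1, e1.2, e2.1, e2.2]
  rw [show t - u - (t - v) = h by linarith] at hD
  change |dualPairing Φ F φ ρ t v - (∫ z, X z ∂(F (t - v)) + h * m (t - v))| ≤ _ at hA
  change dualPairing Φ F φ ρ t u - _ = ∫ r in (t - v)..(t - u), m r at hB
  rw [← hB] at hD
  rw [abs_le] at *
  constructor <;> linarith [hA.1, hA.2, hD.1, hD.2]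

lemma IsBoundedFlow.abs_dualPairing_sub_le (hΦ : IsBoundedFlow G T C Φ)
    (hF : IsContinuousCurve T F) (hweak : SatisfiesWeakForm G T F₀ F) {φ : E → ℝ} {Lφ : ℝ≥0}
    (hφ : LipschitzWith Lφ φ) (hc : HasCompactSupport φ) (ρ : ContDiffBump (0 : E))
    {η h₀ : ℝ} (hη : 0 < η) (hh₀ : 0 < h₀)
    (hρ : ∀ u h, 0 ≤ u → 0 ≤ h → h ≤ h₀ → u + h ≤ T → ∀ p z, ‖p - z‖ ≤ ρ.rOut →
      |φ (Φ (u + h) p) - φ (Φ u (p + h • G z))| ≤ η * h)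
    {t : ℝ} (ht : t ∈ Icc 0 T) :
    |dualPairing Φ F φ ρ t t - dualPairing Φ F φ ρ t 0| ≤ 4 * η * t := by
  -- Right slopes are at most `3η`; the barrier has slope `4η` since strict inequality is required.
  refine image_norm_le_of_liminf_right_slope_norm_lt_deriv_boundary
    (f := fun u => dualPairing Φ F φ ρ t u - dualPairing Φ F φ ρ t 0) (f' := fun _ => 3 * η)
    (B := fun u => 4 * η * u) (B' := fun _ => 4 * η) (a := 0) (b := t)
    ((hΦ.continuousOn_dualPairing hF hφ hc ρ ht).sub continuousOn_const)
    (fun u hu r hr => Eventually.frequently ?_) (by simp) (by fun_prop)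
    (fun u _ => by simpa using ((hasDerivAt_id u).const_mul (4 * η)).hasDerivWithinAt)
    (fun u _ _ => by linarith) (right_mem_Icc.2 ht.1)
  filter_upwards [self_mem_nhdsWithin,
    hΦ.eventually_abs_dualPairing_sub_le hF hweak hφ.continuous hc ρ hη hh₀ hρ ht hu] with v hv h
  have hvu : 0 < v - u := sub_pos.2 hv
  rw [slope_def_field, div_lt_iff₀ hvu]
  refine lt_of_le_of_lt ?_ (mul_lt_mul_of_pos_right hr hvu)
  refine le_trans ?_ h
  refine (norm_sub_norm_le _ _).trans_eq ?_
  rw [sub_sub_sub_cancel_right, Real.norm_eq_abs]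

/-- A continuous curve of measures satisfying the weak form is transported by the flow. -/
lemma IsBoundedFlow.integral_eq (hΦ : IsBoundedFlow G T C Φ) (hF : IsContinuousCurve T F)
    (hweak : SatisfiesWeakForm G T F₀ F) {φ : E → ℝ} (hφ : ContDiff ℝ ∞ φ)
    (hc : HasCompactSupport φ) {t : ℝ} (ht : t ∈ Icc 0 T) :
    ∫ z, φ z ∂(F t) = ∫ z, φ (Φ t z) ∂(F 0) := by
  obtain ⟨Lφ, hL⟩ := hφ.lipschitzWith_of_hasCompactSupport hc (by simp)
  have h0T : (0 : ℝ) ∈ Icc 0 T := left_mem_Icc.2 (ht.1.trans ht.2)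
  refine eq_of_forall_dist_le fun η hη => ?_
  -- The drift `4η't` takes a third of `η`; the mollification errors at `u = 0` and `u = t` take the
  -- others.
  have hη' : 0 < η / (3 * (4 * t + 1)) := by have := ht.1; positivity
  obtain ⟨ε, hε, h₀, hh₀, hstep⟩ := hΦ.exists_abs_comp_sub_le hL hc hη'
  obtain ⟨ε₁, hε₁, hm₁⟩ := exists_abs_integral_mollify_sub_le hφ.continuous hc
    (show 0 < η / 3 by positivity)
  obtain ⟨ε₂, hε₂, hm₂⟩ := exists_abs_integral_mollify_sub_le
    (hφ.continuous.comp (hΦ.continuous ht)) (hΦ.hasCompactSupport_comp hc ht)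
    (show 0 < η / 3 by positivity)
  have hε₃ : 0 < min ε (min ε₁ ε₂) := by positivity
  obtain ⟨ρ, hρ⟩ : ∃ ρ : ContDiffBump (0 : E), ρ.rOut = min ε (min ε₁ ε₂) :=
    ⟨bumpOfRadius hε₃, rfl⟩
  have h1 := hΦ.abs_dualPairing_sub_le hF hweak hL hc ρ hη' hh₀
    (fun u h hu hh hh0 huh p z hpz => hstep u h hu hh hh0 huh p z
      (hpz.trans (hρ ▸ min_le_left _ _))) ht
  have h2 := hm₁ ρ (hρ ▸ (min_le_right _ _).trans (min_le_left _ _)) (F t) (hF.1 t ht).1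
  have h3 := hm₂ ρ (hρ ▸ (min_le_right _ _).trans (min_le_right _ _)) (F 0) (hF.1 0 h0T).1
  have h4 : 4 * (η / (3 * (4 * t + 1))) * t ≤ η / 3 := by
    have := ht.1
    rw [show 4 * (η / (3 * (4 * t + 1))) * t = (η * (4 * t)) / (3 * (4 * t + 1)) by ring,
      div_le_div_iff₀ (by positivity) (by positivity)]
    nlinarith
  have h5 : (fun y => φ (Φ 0 y)) = φ := by simp [hΦ.zero]
  simp only [dualPairing, sub_self, sub_zero, h5] at h1
  simp only [Function.comp_def] at h3
  rw [Real.dist_eq]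
  rw [abs_le] at *
  constructor <;> linarith [h1.1, h1.2, h2.1, h2.2, h3.1, h3.2]

theorem IsBoundedFlow.eq_map (hΦ : IsBoundedFlow G T C Φ) [IsProbabilityMeasure F₀]
    (hF : IsContinuousCurve T F) (hweak : SatisfiesWeakForm G T F₀ F) {t : ℝ}
    (ht : t ∈ Icc 0 T) : F t = F₀.map (Φ t) := by
  have h0T : (0 : ℝ) ∈ Icc 0 T := left_mem_Icc.2 (ht.1.trans ht.2)
  have hp0 := (hF.1 0 h0T).1
  have hpt := (hF.1 t ht).1
  have hmeas : Measurable (Φ t) := (hΦ.continuous ht).measurable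
  have h0 : F 0 = F₀ := ext_of_integral_smooth fun φ hφ hc => by simpa using hweak φ hφ hc 0 h0T
  have := Measure.isProbabilityMeasure_map (μ := F₀) hmeas.aemeasurable
  refine ext_of_integral_smooth fun φ hφ hc => ?_
  rw [hΦ.integral_eq hF hweak hφ hc ht, h0,
    integral_map hmeas.aemeasurable hφ.continuous.aestronglyMeasurable]

end WeakUniqueness

/-! ### Push-forwards: weak form and continuous dependence -/

section PushForward

variable {E : Type*} [NormedAddCommGroup E] [NormedSpace ℝ E] [FiniteDimensional ℝ E]
  [MeasurableSpace E] [BorelSpace E] {G : E → E} {T C : ℝ} {Φ : ℝ → E → E} {F₀ : Measure E}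

lemma IsBoundedFlow.isP1_map (hΦ : IsBoundedFlow G T C Φ) (hF₀ : IsP1 F₀) {t : ℝ}
    (ht : t ∈ Icc 0 T) : IsP1 (F₀.map (Φ t)) := by
  have := hF₀.1
  have hmeas := (hΦ.continuous ht).measurable
  refine ⟨Measure.isProbabilityMeasure_map hmeas.aemeasurable, ?_⟩
  rw [lintegral_map (by fun_prop) hmeas]
  refine lt_of_le_of_lt (lintegral_mono fun z => (?_ : _ ≤ ‖z‖ₑ + ENNReal.ofReal (C * t))) ?_
  · rw [← ofReal_norm, ← ofReal_norm, ← ENNReal.ofReal_add (norm_nonneg _)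
      (mul_nonneg hΦ.bound_nonneg ht.1)]
    refine ENNReal.ofReal_le_ofReal ?_
    linarith [norm_le_insert' (Φ t z) z, hΦ.norm_sub_self_le z ht]
  · rw [lintegral_add_right _ measurable_const]
    simpa using hF₀.2

/-- Moving each point along its own trajectory is a plan of cost at most `C * |s - t|`. -/
lemma IsBoundedFlow.isContinuousCurve_map (hΦ : IsBoundedFlow G T C Φ) (hF₀ : IsP1 F₀) :
    IsContinuousCurve T fun t => F₀.map (Φ t) := by
  have := hF₀.1
  refine ⟨fun t ht => hΦ.isP1_map hF₀ ht, fun t ht => ?_⟩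
  have hlim : Tendsto (fun s => ENNReal.ofReal (C * |s - t|)) (𝓝[Icc 0 T] t) (𝓝 0) := by
    have : Continuous fun s : ℝ => ENNReal.ofReal (C * |s - t|) :=
      ENNReal.continuous_ofReal.comp (by fun_prop)
    simpa using (this.tendsto t).mono_left nhdsWithin_le_nhds
  refine tendsto_of_tendsto_of_tendsto_of_le_of_le' tendsto_const_nhds hlim
    (Eventually.of_forall fun _ => zero_le) (eventually_nhdsWithin_of_forall fun s hs => ?_)
  refine (wass1_map_map_le F₀ (hΦ.continuous hs).measurable (hΦ.continuous ht).measurable).trans ?_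
  refine (lintegral_mono fun z => (?_ : _ ≤ ENNReal.ofReal (C * |s - t|))).trans (by simp)
  rw [← ofReal_norm]
  exact ENNReal.ofReal_le_ofReal (hΦ.norm_sub_le z ht hs)

omit [FiniteDimensional ℝ E] [MeasurableSpace E] [BorelSpace E] in
lemma IsBoundedFlow.comp_sub_eq_integral (hΦ : IsBoundedFlow G T C Φ) {φ : E → ℝ}
    (hφ : ContDiff ℝ ∞ φ) (z : E) {t : ℝ} (ht : t ∈ Icc 0 T) :
    φ (Φ t z) - φ z = ∫ s in (0 : ℝ)..t, fderiv ℝ φ (Φ s z) (G (Φ s z)) := by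
  have hsub : Icc 0 t ⊆ Icc 0 T := Icc_subset_Icc_right ht.2
  have hcont := (hΦ.continuousOn_curve z).mono hsub
  rw [intervalIntegral.integral_eq_sub_of_hasDerivAt_of_le ht.1
    (f := fun s => φ (Φ s z)) (hφ.continuous.comp_continuousOn hcont) ?_ ?_, hΦ.zero]
  · intro s hs
    have h1 := (hΦ.hasDerivWithinAt z s (hsub (Ioo_subset_Icc_self hs))).hasDerivAt
      (Icc_mem_nhds hs.1 (hs.2.trans_le ht.2))
    exact (hφ.differentiable (by simp) (Φ s z)).hasFDerivAt.comp_hasDerivAt s h1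
  · refine ContinuousOn.intervalIntegrable ?_
    rw [uIcc_of_le ht.1]
    exact (continuous_fderiv_apply hφ hΦ.continuous_field).comp_continuousOn hcont

lemma IsBoundedFlow.satisfiesWeakForm_map (hΦ : IsBoundedFlow G T C Φ)
    [IsProbabilityMeasure F₀] : SatisfiesWeakForm G T F₀ fun t => F₀.map (Φ t) := by
  intro φ hφ hc t ht
  have hg := continuous_fderiv_apply hφ hΦ.continuous_field
  have hgc : HasCompactSupport fun z => fderiv ℝ φ z (G z) := hasCompactSupport_fderiv_apply hc
  obtain ⟨M, hM⟩ := hg.bounded_above_of_compact_support hgc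
  set g : E → ℝ := fun z => fderiv ℝ φ z (G z)
  have hT : (0 : ℝ) ≤ T := ht.1.trans ht.2
  -- Clamping time to `[0,T]`, outside which `Φ` is uncontrolled, makes `f` jointly measurable for
  -- Fubini.
  let f : ℝ → E → ℝ := fun s z => g (Φ (projIcc 0 T hT s) z)
  have hf : ∀ s ∈ uIcc 0 t, ∀ z, f s z = g (Φ s z) := fun s hs z => by
    rw [uIcc_of_le ht.1] at hs
    simp only [f, projIcc_of_mem hT ⟨hs.1, hs.2.trans ht.2⟩]
  have hfm : StronglyMeasurable (Function.uncurry f) := by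
    refine (measurable_uncurry_of_continuous_of_measurable (fun z => ?_)
      fun s => ?_).stronglyMeasurable
    · exact hg.comp ((hΦ.continuousOn_curve z).comp_continuous
        (continuous_subtype_val.comp continuous_projIcc) fun s => (projIcc 0 T hT s).2)
    · exact (hg.comp (hΦ.continuous (projIcc 0 T hT s).2)).measurable
  have : IsFiniteMeasure (volume.restrict (uIoc 0 t)) :=
    isFiniteMeasure_restrict.2 (by simp [uIoc])
  have hfi : Integrable (Function.uncurry f) ((volume.restrict (uIoc 0 t)).prod F₀) :=
    Integrable.of_bound hfm.aestronglyMeasurable M (Eventually.of_forall fun p => hM _)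
  have hmeas := (hΦ.continuous ht).measurable
  have hlhs : ∫ z, φ z ∂(F₀.map (Φ t)) = ∫ z, φ (Φ t z) ∂F₀ :=
    integral_map hmeas.aemeasurable hφ.continuous.aestronglyMeasurable
  have hrhs : ∫ s in (0 : ℝ)..t, (∫ z, g z ∂(F₀.map (Φ s))) =
      ∫ s in (0 : ℝ)..t, (∫ z, f s z ∂F₀) := by
    refine intervalIntegral.integral_congr fun s hs => ?_
    have hs' := hs
    rw [uIcc_of_le ht.1] at hs'
    simp only [hf s hs]
    exact integral_map (hΦ.continuous ⟨hs'.1, hs'.2.trans ht.2⟩).measurable.aemeasurable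
      hg.aestronglyMeasurable
  have hpt : ∀ z, ∫ s in (0 : ℝ)..t, f s z = φ (Φ t z) - φ z := fun z => by
    rw [hΦ.comp_sub_eq_integral hφ z ht]
    exact intervalIntegral.integral_congr fun s hs => hf s hs z
  change _ = _ + ∫ s in (0 : ℝ)..t, (∫ z, g z ∂(F₀.map (Φ s)))
  rw [hlhs, hrhs, intervalIntegral_integral_swap hfi]
  simp only [hpt]
  have hint : Integrable (fun z => φ (Φ t z)) F₀ :=
    (hφ.continuous.comp (hΦ.continuous ht)).integrable_of_compactSupport
      (hΦ.hasCompactSupport_comp hc ht) F₀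
  rw [integral_sub hint (hφ.continuous.integrable_of_compactSupport hc F₀)]
  simp

/-- Continuous dependence of the push-forward on the initial measure. -/
lemma IsBoundedFlow.exists_wass1_map_lt (hΦ : IsBoundedFlow G T C Φ) (hF₀ : IsP1 F₀) {ε : ℝ≥0∞}
    (hε : 0 < ε) : ∃ δ : ℝ≥0∞, 0 < δ ∧ ∀ F₀' : Measure E, wass1 F₀ F₀' < δ →
      ∀ t ∈ Icc 0 T, wass1 (F₀.map (Φ t)) (F₀'.map (Φ t)) < ε := by
  obtain ⟨e, he0, he⟩ := ENNReal.lt_iff_exists_nnreal_btwn.1 hε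
  have he0 : 0 < e := by exact_mod_cast he0
  obtain ⟨m, hm⟩ : ∃ m : ℝ≥0, (m : ℝ≥0∞) = ∫⁻ z, ‖z‖ₑ ∂F₀ :=
    ⟨_, ENNReal.coe_toNNReal hF₀.2.ne⟩
  -- With `m` the first moment of `F₀`, the term `k * m` uses at most half of `e`; `δ = e / (2D)`
  -- leaves the other half to the plan.
  obtain ⟨D, hD, hle⟩ := hΦ.exists_norm_sub_le_add (k := e / (2 * (m + 1))) (by positivity)
  refine ⟨(e / (2 * D) : ℝ≥0), by exact_mod_cast (by positivity : 0 < e / (2 * D)),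
    fun F₀' hlt t ht => ?_⟩
  obtain ⟨π, hπ, hcost⟩ := exists_plan_of_wass1_lt hlt
  refine lt_of_le_of_lt ?_ he
  have hfst : ∫⁻ p, ‖p.1‖ₑ ∂π = m := by
    rw [hm, ← hπ.1, lintegral_map (by fun_prop) measurable_fst]
  calc wass1 (F₀.map (Φ t)) (F₀'.map (Φ t))
      ≤ ∫⁻ p, ‖Φ t p.1 - Φ t p.2‖ₑ ∂π :=
        wass1_map_le_of_plan hπ (hΦ.continuous ht).measurable
    _ ≤ ∫⁻ p, (D * ‖p.1 - p.2‖ₑ + (e / (2 * (m + 1)) : ℝ≥0) * ‖p.1‖ₑ) ∂π := by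
        refine lintegral_mono fun p => ?_
        simp only [enorm_eq_nnnorm]
        exact_mod_cast hle t ht p.1 p.2
    _ = D * ∫⁻ p, ‖p.1 - p.2‖ₑ ∂π + (e / (2 * (m + 1)) : ℝ≥0) * m := by
        rw [lintegral_add_left (by fun_prop), lintegral_const_mul _ (by fun_prop),
          lintegral_const_mul _ (by fun_prop), hfst]
    _ ≤ D * (e / (2 * D) : ℝ≥0) + (e / (2 * (m + 1)) : ℝ≥0) * m := by gcongr
    _ ≤ e := by
        norm_cast
        rw [← NNReal.coe_le_coe]
        push_cast
        have h1 : (D : ℝ) * (e / (2 * D)) = e / 2 := by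
          have : (D : ℝ) ≠ 0 := by exact_mod_cast hD.ne'
          field_simp
        have h2 : (e : ℝ) / (2 * (m + 1)) * m ≤ e / 2 := by
          rw [div_mul_eq_mul_div, div_le_div_iff₀ (by positivity) (by positivity)]
          nlinarith [e.coe_nonneg, m.coe_nonneg]
        linarith

end PushForward

/-! ### Empirical measures -/

section Empirical

variable {E : Type*} [MeasurableSpace E] {M : ℕ}

lemma map_empirical {f : E → E} (hf : Measurable f) (z : Fin M → E) :
    (empirical z).map f = empirical fun i => f (z i) := by
  ext s hs
  rw [Measure.map_apply hf hs]
  simp [empirical, Measure.dirac_apply' _ hs, Measure.dirac_apply' _ (hf hs), indicator]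
  rfl

lemma ae_empirical {z : Fin M → E} {P : E → Prop} (hP : MeasurableSet {y | P y})
    (h : ∀ i, P (z i)) : ∀ᵐ y ∂(empirical z), P y := by
  rw [ae_iff]
  have : {y | ¬ P y} = {y | P y}ᶜ := rfl
  simp [this, empirical, Measure.dirac_apply' _ hP.compl, h]

end Empirical

/-! ### Dobrushin estimate, mean-field limit, main theorem -/

section Main

variable {d : ℕ} {σ : Vec d → Vec d} {w : ℝ → Matrix (Fin d) (Fin d) ℝ} {b : ℝ → Vec d} {T : ℝ}
  {Φ : ℝ → Phase d → Phase d}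

/-- Any plan must carry each point to the hyperplane `τ = 0`, at a cost of at least `|τ|`. -/
lemma lintegral_enorm_tauPart_le_wass1 {μ ν : Measure (Phase d)}
    (hν : ∀ᵐ z ∂ν, tauPart z = 0) : ∫⁻ z, ‖tauPart z‖ₑ ∂μ ≤ wass1 μ ν := by
  refine le_iInf₂ fun π hπ => ?_
  have hmeas : Measurable (tauPart : Phase d → ℝ) := continuous_tauPart.measurable
  rw [← hπ.1, lintegral_map hmeas.enorm measurable_fst]
  refine lintegral_mono_ae ?_
  filter_upwards [ae_snd_of_plan hπ hν] with p hp
  rw [← ofReal_norm, ← ofReal_norm]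
  refine ENNReal.ofReal_le_ofReal ?_
  rw [← sub_zero (tauPart p.1), ← hp, ← tauPart_sub]
  exact abs_tauPart_le _

lemma ae_tauPart_eq_zero_of_tendsto {ι : Type*} {l : Filter ι} [l.NeBot] {μ : Measure (Phase d)}
    {ν : ι → Measure (Phase d)} (hν : ∀ i, ∀ᵐ z ∂(ν i), tauPart z = 0)
    (h : Tendsto (fun i => wass1 μ (ν i)) l (𝓝 0)) : ∀ᵐ z ∂μ, tauPart z = 0 := by
  have hle : ∫⁻ z, ‖tauPart z‖ₑ ∂μ ≤ 0 :=
    ge_of_tendsto' h fun i => lintegral_enorm_tauPart_le_wass1 (hν i)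
  have hmeas : Measurable (tauPart : Phase d → ℝ) := continuous_tauPart.measurable
  filter_upwards [(lintegral_eq_zero_iff hmeas.enorm).1 (nonpos_iff_eq_zero.1 hle)] with z hz
  simpa using hz

lemma IsCharFlow.exists_wass1_map_le (hΦ : IsCharFlow σ w b T Φ)
    (hσ : ∃ K : ℝ≥0, LipschitzWith K σ) (hw : ∃ K : ℝ≥0, LipschitzWith K w) (hb : Continuous b)
    {C : ℝ} (hC : ∀ z, ‖fieldG σ w b z‖ ≤ C) {A : Set ℝ} (hA : ∃ B : ℝ, ∀ τ ∈ A, ‖w τ‖ ≤ B) :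
    ∃ L : ℝ≥0, ∀ μ ν : Measure (Phase d), (∀ᵐ z ∂μ, tauPart z ∈ A) → (∀ᵐ z ∂ν, tauPart z ∈ A) →
      ∀ t ∈ Icc 0 T, wass1 (μ.map (Φ t)) (ν.map (Φ t)) ≤ L * wass1 μ ν := by
  obtain ⟨L, hL⟩ := hΦ.exists_lipschitz hσ hw hC hA
  -- Adding `1` keeps the constant nonzero, as `wass1_map_le_mul` demands.
  refine ⟨L + 1, fun μ ν hμ hν t ht => ?_⟩
  refine wass1_map_le_mul ((hΦ.isBoundedFlow hσ hw hb hC).continuous ht).measurable (by positivity)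
    (S := {z | tauPart z ∈ A}) hμ hν fun y hy z hz => (hL t ht y z hy hz).trans ?_
  gcongr
  linarith

lemma IsTrajectory.phasePt_eq (hσ : ∃ K : ℝ≥0, LipschitzWith K σ) (hw : Continuous w)
    (hΦ : IsCharFlow σ w b T Φ) {x₀ : Vec d} {x : ℝ → Vec d} {τ : ℝ → ℝ}
    (h : IsTrajectory σ w b T x₀ x τ) {t : ℝ} (ht : t ∈ Icc 0 T) :
    phasePt (x t) (τ t) = Φ t (phasePt x₀ 0) := by
  have := hΦ.eq hσ hw (z := fun t => phasePt (x t) (τ t))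
    (fun s hs => by simpa [fieldG] using (h.1.2 s hs).phasePt (h.2.2 s hs)) ht
  simpa [h.1.1, h.2.1] using this

lemma IsWeakSolution.eq_map {C : ℝ} (hΦ : IsBoundedFlow (fieldG σ w b) T C Φ)
    {F₀ : Measure (Phase d)} {F : ℝ → Measure (Phase d)} (hF₀ : IsP1 F₀)
    (hF : IsWeakSolution σ w b T F₀ F) {t : ℝ} (ht : t ∈ Icc 0 T) : F t = F₀.map (Φ t) :=
  have := hF₀.1
  hΦ.eq_map hF.1 hF.2 ht

end Main

theorem mainTheorem1 {d : ℕ} (σ : Vec d → Vec d) (w : ℝ → Matrix (Fin d) (Fin d) ℝ)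
    (b : ℝ → Vec d)
    (hσ : ∃ K : ℝ≥0, LipschitzWith K σ) (hw : ∃ K : ℝ≥0, LipschitzWith K w)
    (hb : ∃ K : ℝ≥0, LipschitzWith K b) (hσb : ∃ C₀ : ℝ, ∀ x, ‖σ x‖ ≤ C₀)
    (T : ℝ) (hT : 0 < T) :
    -- the characteristic flow exists, is unique on `[0,T]` and consists of continuous maps;
    -- its push-forward is the unique weak solution
    (∃ Φ : ℝ → Phase d → Phase d,
      IsCharFlow σ w b T Φ ∧
      (∀ Ψ, IsCharFlow σ w b T Ψ → ∀ t ∈ Icc 0 T, Ψ t = Φ t) ∧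
      (∀ t ∈ Icc 0 T, Continuous (Φ t)) ∧
      ∀ F₀ : Measure (Phase d), IsP1 F₀ →
        IsWeakSolution σ w b T F₀ (fun t => F₀.map (Φ t)) ∧
        ∀ F, IsWeakSolution σ w b T F₀ F → ∀ t ∈ Icc 0 T, F t = F₀.map (Φ t)) ∧
    -- continuous dependence on the initial datum, uniformly on `[0,T]`
    (∀ F₀ F, IsP1 F₀ → IsWeakSolution σ w b T F₀ F →
      ∀ ε : ℝ≥0∞, 0 < ε → ∃ δ : ℝ≥0∞, 0 < δ ∧
        ∀ F₀' F', IsP1 F₀' → IsWeakSolution σ w b T F₀' F' → wass1 F₀ F₀' < δ →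
          ∀ t ∈ Icc 0 T, wass1 (F t) (F' t) < ε) ∧
    -- Dobrushin estimate for data concentrated on `ℝ^d × A` with `w` bounded on `A`
    -- (all data if `w` is bounded; always for data concentrated on a bounded range of `τ`)
    (∀ A : Set ℝ, (∃ B : ℝ, ∀ τ ∈ A, ‖w τ‖ ≤ B) →
      ∃ C : ℝ≥0, ∀ F₀ F₀' F F', IsP1 F₀ → IsP1 F₀' →
        (∀ᵐ z ∂F₀, tauPart z ∈ A) → (∀ᵐ z ∂F₀', tauPart z ∈ A) →
        IsWeakSolution σ w b T F₀ F → IsWeakSolution σ w b T F₀' F' →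
        ∀ t ∈ Icc 0 T, wass1 (F t) (F' t) ≤ C * wass1 F₀ F₀') ∧
    -- mean-field limit of the particle system
    (∃ C : ℝ≥0, ∀ F₀ F, IsP1 F₀ → IsWeakSolution σ w b T F₀ F →
      ∀ (x₀ : (M : ℕ) → Fin M → Vec d) (x : (M : ℕ) → Fin M → ℝ → Vec d)
        (τ : (M : ℕ) → Fin M → ℝ → ℝ),
        (∀ M i, IsTrajectory σ w b T (x₀ M i) (x M i) (τ M i)) →
        Tendsto (fun M => wass1 F₀ (empirical fun i => phasePt (x₀ M i) 0)) atTop (𝓝 0) →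
        (∀ M, 1 ≤ M → ∀ t ∈ Icc 0 T,
          wass1 (F t) (empirical fun i => phasePt (x M i t) (τ M i t)) ≤
            C * wass1 F₀ (empirical fun i => phasePt (x₀ M i) 0)) ∧
        Tendsto (fun M => ⨆ t ∈ Icc 0 T,
          wass1 (F t) (empirical fun i => phasePt (x M i t) (τ M i t))) atTop (𝓝 0)) := by
  have hwc : Continuous w := hw.choose_spec.continuous
  have hbc : Continuous b := hb.choose_spec.continuous
  obtain ⟨C₀, hC₀⟩ := hσb
  have hC : ∀ z, ‖fieldG σ w b z‖ ≤ C₀ + 1 := norm_fieldG_le hC₀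
  obtain ⟨Φ, hΦ⟩ := exists_isCharFlow hσ hwc hbc ⟨C₀, hC₀⟩ hT.le
  have hflow := hΦ.isBoundedFlow hσ hw hbc hC
  refine ⟨⟨Φ, hΦ, fun Ψ hΨ t ht => funext fun z => ?_, fun t ht => hflow.continuous ht,
    fun F₀ hF₀ => ⟨⟨hflow.isContinuousCurve_map hF₀, ?_⟩, fun F hF t ht => hF.eq_map hflow hF₀ ht⟩⟩,
    fun F₀ F hF₀ hF ε hε => ?_, fun A hA => ?_, ?_⟩
  · rw [hΦ.eq hσ hwc (hΨ z).2 ht, (hΨ z).1]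
  · have := hF₀.1
    exact hflow.satisfiesWeakForm_map
  · obtain ⟨δ, hδ, h⟩ := hflow.exists_wass1_map_lt hF₀ hε
    refine ⟨δ, hδ, fun F₀' F' hF₀' hF' hlt t ht => ?_⟩
    rw [hF.eq_map hflow hF₀ ht, hF'.eq_map hflow hF₀' ht]
    exact h F₀' hlt t ht
  · obtain ⟨L, hL⟩ := hΦ.exists_wass1_map_le hσ hw hbc hC hA
    refine ⟨L, fun F₀ F₀' F F' hF₀ hF₀' hA hA' hF hF' t ht => ?_⟩
    rw [hF.eq_map hflow hF₀ ht, hF'.eq_map hflow hF₀' ht]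
    exact hL F₀ F₀' hA hA' t ht
  -- On the single point `τ = 0` any `w` is bounded.
  · obtain ⟨L, hL⟩ := hΦ.exists_wass1_map_le hσ hw hbc hC (A := {0})
      ⟨‖w 0‖, fun τ hτ => by rw [mem_singleton_iff.1 hτ]⟩
    refine ⟨L, fun F₀ F hF₀ hF x₀ x τ htraj hlim => ?_⟩
    have hemp : ∀ M, ∀ᵐ z ∂(empirical fun i => phasePt (x₀ M i) 0), tauPart z = 0 := fun M =>
      ae_empirical (measurableSet_eq_fun continuous_tauPart.measurable measurable_const)
        fun i => tauPart_phasePt _ _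
    have hzero := ae_tauPart_eq_zero_of_tendsto hemp hlim
    -- `M = 0`, where `empirical` is the zero measure, is included so that the squeeze holds for
    -- every index.
    have hbound : ∀ M, ∀ t ∈ Icc 0 T,
        wass1 (F t) (empirical fun i => phasePt (x M i t) (τ M i t)) ≤
          L * wass1 F₀ (empirical fun i => phasePt (x₀ M i) 0) := by
      intro M t ht
      simp only [(htraj M _).phasePt_eq hσ hwc hΦ ht]
      rw [hF.eq_map hflow hF₀ ht, ← map_empirical (hflow.continuous ht).measurable]
      exact hL _ _ hzero (hemp M) t ht
    refine ⟨fun M _ => hbound M, ?_⟩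
    have hlim' := ENNReal.Tendsto.const_mul (a := (L : ℝ≥0∞)) hlim (Or.inr ENNReal.coe_ne_top)
    rw [mul_zero] at hlim'
    exact tendsto_of_tendsto_of_tendsto_of_le_of_le tendsto_const_nhds hlim'
      (fun _ => zero_le) fun M => iSup₂_le (hbound M)
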